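/- Conventions. An acyclic directed mixed graph (ADMG) $\mathcal G$ on a finite vertex set $V$ consists of a directed acyclic graph on $V$ together with a set of unordered pairs of distinct vertices, written $v\leftrightarrow w$; a pair of vertices may be joined by both kinds of edge. A path is a sequence of adjacent edges without repeated vertices. For $W\subseteq V$, $\mathrm{an}(W)\supseteq W$ is the set of ancestors of elements of $W$, $\mathrm{pa}(W)$ is the set of parents of elements of $W$, and $A\subseteq V$ is ancestral if $\mathrm{an}(A)=A$. For $W\subseteq A$, $\mathrm{dis}_A(W)$ is the set of vertices joined to $W$ by (possibly empty) bidirected paths inside $A$. A non-endpoint vertex of a path is a collider if both adjacent edges of the path have an arrowhead at it. A path between $v$ and $w$ is blocked by $C\subseteq V\setminus\{v,w\}$ if it has a non-collider in $C$ or a collider outside $\mathrm{an}(C)$; disjoint sets $A,B$ are m-separated given $C$ (disjoint from $A\cup B$) if every path from a vertex of $A$ to a vertex of $B$ is blocked by $C$. A probability distribution $P$ of $X_V=(X_v)_{v\in V}$ obeys the global Markov property for $\mathcal G$ if, for all pairwise disjoint $A,B,C\subseteq V$ with $A,B$ non-empty, m-separation of $A$ and $B$ given $C$ implies that $X_A$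 and $X_B$ are conditionally independent given $X_C$. A head is a non-empty set $H\subseteq V$ such that no element of $H$ is an ancestor of a different element of $H$ and $H$ is contained in a single district (bidirected-connected component) of the induced subgraph $\mathcal G_{\mathrm{an}(H)}$. Its tail is $T=T(H)=(\mathrm{dis}_{\mathrm{an}(H)}(H)\setminus H)\cup\mathrm{pa}(\mathrm{dis}_{\mathrm{an}(H)}(H))$. For distinct heads write $H\prec H'$ if $H\subseteq\mathrm{an}(H')$; this is a strict partial order. For $W\subseteq V$ let $\Phi(W)$ be the set of $\prec$-maximal elements among the heads contained in $W$, let $\psi(W)=W\setminus\bigcup_{H\in\Phi(W)}H$, and define recursively $[\emptyset]_{\mathcal G}=\emptyset$ and $[W]_{\mathcal G}=\Phi(W)\cup[\psi(W)]_{\mathcal G}$. Theorem. Let $\mathcal G$ be an ADMG with finite vertex set $V$, and let $P$ be a probability distribution on $\{0,1\}^{V}$. Then $P$ obeys the global Markov property for $\mathcal G$ if and only if, for every ancestral set $A$ and every $x_A\in\{0,1\}^A$ for which all the conditional probabilities on the right-hand side are defined (that is, $P(X_T=x_T)>0$ for the tail $T$ of every head $H\in[C]_{\mathcal G}$ and every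 $C$ with $O\subseteq C\subseteq A$), $$P(X_A=x_A)=\sum_{C:\,O\subseteq C\subseteq A}(-1)^{|C\setminus O|}\prod_{H\in[C]_{\mathcal G}}P(X_H=0\mid X_T=x_T),$$ where $O=\{v\in A: x_v=0\}$ and an empty product equals $1$. In particular, if $P$ is strictly positive, the formula is required for every ancestral $A$ and every $x_A$. -/

import Mathlib

open MeasureTheory ProbabilityTheory

/-- An acyclic directed mixed graph on the vertex set `V`: a directed acyclic graph together with
a set of unordered pairs of distinct vertices (bidirected edges).  A pair of vertices may be
joined by a directed edge and a bidirected edge at the same time. -/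
structure ADMG (V : Type*) where
  /-- `dir v w` is the directed edge `v → w`. -/
  dir : V → V → Prop
  /-- `bi v w` is the bidirected edge `v ↔ w`. -/
  bi : V → V → Prop
  acyclic : ∀ v, ¬ Relation.TransGen dir v v
  bi_symm : ∀ v w, bi v w → bi w v
  bi_irrefl : ∀ v, ¬ bi v v

namespace ADMG

/-- The ways in which an edge can be traversed from `v` to `w`:
`v → w`, `v ← w`, `v ↔ w`. -/
inductive EdgeKind
  | forward
  | backward
  | bidirected

/-- The traversed edge has an arrowhead at the vertex where it starts. -/
def EdgeKind.ArrowAtStart : EdgeKind → Prop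
  | forward => False
  | backward => True
  | bidirected => True

/-- The traversed edge has an arrowhead at the vertex where it ends. -/
def EdgeKind.ArrowAtEnd : EdgeKind → Prop
  | forward => True
  | backward => False
  | bidirected => True

section Paths

variable {V : Type*} (G : ADMG V)

/-- `G` has an edge of the given kind from `v` to `w`. -/
def HasEdge : EdgeKind → V → V → Prop
  | EdgeKind.forward, v, w => G.dir v w
  | EdgeKind.backward, v, w => G.dir w v
  | EdgeKind.bidirected, v, w => G.bi v w

/-- A path from `v` to `w`: a sequence of adjacent edges without repetition of a vertex.  Its
vertices are `vert 0, …, vert length`, and `edge i` joins `vert i` to `vert (i + 1)` for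
`i < length` (other values of `vert` and `edge` are irrelevant). -/
structure Path (v w : V) where
  length : ℕ
  vert : ℕ → V
  edge : ℕ → EdgeKind
  vert_zero : vert 0 = v
  vert_length : vert length = w
  hasEdge : ∀ i < length, G.HasEdge (edge i) (vert i) (vert (i + 1))
  injOn : Set.InjOn vert (Set.Iic length)

variable {G} in
/-- The non-endpoint `vert (i + 1)` is a collider: both path edges at it have an arrowhead
there. -/
def Path.IsCollider {v w : V} (p : G.Path v w) (i : ℕ) : Prop :=
  (p.edge i).ArrowAtEnd ∧ (p.edge (i + 1)).ArrowAtStart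

/-- `w` is an ancestor of `v` (possibly `w = v`). -/
def Anc (w v : V) : Prop := Relation.ReflTransGen G.dir w v

variable {G} in
/-- The path is blocked by `C`: some non-collider on it lies in `C`, or some collider on it is
not an ancestor of a vertex of `C`.  (The non-endpoints of the path are `vert (i + 1)` with
`i + 1 < length`.) -/
def Path.Blocked {v w : V} (p : G.Path v w) (C : Finset V) : Prop :=
  (∃ i, i + 1 < p.length ∧ ¬ p.IsCollider i ∧ p.vert (i + 1) ∈ C) ∨
  (∃ i, i + 1 < p.length ∧ p.IsCollider i ∧ ¬ ∃ c ∈ C, G.Anc (p.vert (i + 1)) c)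

/-- `A` and `B` are m-separated given `C`. -/
def MSep (A B C : Finset V) : Prop :=
  ∀ a ∈ A, ∀ b ∈ B, ∀ p : G.Path a b, p.Blocked C

theorem anc_antisymm {v w : V} (h : G.Anc v w) (h' : G.Anc w v) : v = w := by
  rcases Relation.reflTransGen_iff_eq_or_transGen.mp h with h1 | h1
  · exact h1.symm
  · exact absurd (h1.trans_left h') (G.acyclic v)

end Paths

section Heads

variable {V : Type*} [Fintype V] [DecidableEq V] (G : ADMG V)

open Classical in
/-- The ancestors of a set of vertices. -/
noncomputable def an (W : Finset V) : Finset V :=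
  Finset.univ.filter fun w => ∃ v ∈ W, G.Anc w v

open Classical in
/-- The descendants of a set of vertices. -/
noncomputable def de (W : Finset V) : Finset V :=
  Finset.univ.filter fun w => ∃ v ∈ W, G.Anc v w

open Classical in
/-- The parents of a set of vertices. -/
noncomputable def pa (W : Finset V) : Finset V :=
  Finset.univ.filter fun w => ∃ v ∈ W, G.dir w v

open Classical in
/-- `G.dis A W` is the union of the districts, in the induced subgraph on `A`, of the vertices
of `W` (for `W ⊆ A`). -/
noncomputable def dis (A W : Finset V) : Finset V :=
  Finset.univ.filter fun w =>
    ∃ v ∈ W, Relation.ReflTransGen (fun a b => a ∈ A ∧ b ∈ A ∧ G.bi a b) v w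

/-- A set of vertices is ancestral if it contains all its ancestors. -/
def IsAncestral (A : Finset V) : Prop := G.an A = A

/-- The vertices of `B` none of whose strict descendants lie in `B`. -/
noncomputable def barren (B : Finset V) : Finset V :=
  B.filter fun v => G.de {v} ∩ B = {v}

/-- A head is a non-empty barren set contained in a single district of the induced subgraph on
its ancestors. -/
def IsHead (H : Finset V) : Prop :=
  H.Nonempty ∧ G.barren H = H ∧ ∃ v ∈ G.an H, H ⊆ G.dis (G.an H) {v}

/-- The tail of a head. -/
noncomputable def tail (H : Finset V) : Finset V :=
  (G.dis (G.an H) H \ H) ∪ G.pa (G.dis (G.an H) H)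

/-- The strict partial order `≺` on heads. -/
def Prec (H K : Finset V) : Prop := H ≠ K ∧ H ⊆ G.an K

open Classical in
/-- `Φ(W)`: the `≺`-maximal elements among the heads contained in `W`. -/
noncomputable def maxHeads (W : Finset V) : Finset (Finset V) :=
  W.powerset.filter fun H => G.IsHead H ∧ ∀ K ⊆ W, G.IsHead K → ¬ G.Prec H K

/-- `ψ(W)`: the elements of `W` contained in no set of `Φ(W)`. -/
noncomputable def rest (W : Finset V) : Finset V :=
  W \ (G.maxHeads W).biUnion id

theorem mem_an {W : Finset V} {w : V} : w ∈ G.an W ↔ ∃ v ∈ W, G.Anc w v := by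
  simp [an]

theorem isHead_singleton (v : V) : G.IsHead {v} := by
  refine ⟨Finset.singleton_nonempty v, ?_, v, ?_, ?_⟩
  · refine Finset.filter_true_of_mem fun w hw => ?_
    rw [Finset.mem_singleton] at hw
    subst hw
    refine Finset.inter_eq_right.mpr (Finset.singleton_subset_iff.mpr ?_)
    simp only [de, Finset.mem_filter, Finset.mem_univ, true_and, Finset.mem_singleton,
      exists_eq_left]
    exact Relation.ReflTransGen.refl
  · exact G.mem_an.mpr ⟨v, Finset.mem_singleton_self v, Relation.ReflTransGen.refl⟩
  · intro w hw
    simp only [Finset.mem_singleton] at hw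
    subst hw
    simp only [dis, Finset.mem_filter, Finset.mem_univ, true_and, Finset.mem_singleton,
      exists_eq_left]
    exact Relation.ReflTransGen.refl

theorem IsHead.eq_of_anc {H : Finset V} (hH : G.IsHead H) {v w : V} (hv : v ∈ H) (hw : w ∈ H)
    (h : G.Anc v w) : w = v := by
  have h1 : v ∈ G.barren H := by rw [hH.2.1]; exact hv
  have h2 : G.de {v} ∩ H = {v} := (Finset.mem_filter.mp h1).2
  have h3 : w ∈ G.de {v} ∩ H := by simp [de, hw, h]
  rw [h2] at h3
  exact Finset.mem_singleton.mp h3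

theorem head_antisymm {H K : Finset V} (hH : G.IsHead H)
    (h1 : H ⊆ G.an K) (h2 : K ⊆ G.an H) : H ⊆ K := by
  intro v hv
  obtain ⟨w, hw, hvw⟩ := G.mem_an.mp (h1 hv)
  obtain ⟨u, hu, hwu⟩ := G.mem_an.mp (h2 hw)
  have h3 : u = v := IsHead.eq_of_anc G hH hv hu (hvw.trans hwu)
  subst h3
  rw [G.anc_antisymm hvw hwu]
  exact hw

/-- Every non-empty set contains a maximal head, so that removing all maximal heads makes the set
strictly smaller. -/
theorem rest_ssubset {W : Finset V} (hW : W.Nonempty) : G.rest W ⊂ W := by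
  classical
  obtain ⟨v, hv⟩ := hW
  have hne : (W.powerset.filter fun H => G.IsHead H).Nonempty :=
    ⟨{v}, by simpa using ⟨hv, G.isHead_singleton v⟩⟩
  obtain ⟨H, hH, hmax⟩ := Finset.exists_max_image _ (fun H => (G.an H).card) hne
  simp only [Finset.mem_filter, Finset.mem_powerset] at hH hmax
  have hmem : H ∈ G.maxHeads W := by
    simp only [maxHeads, Finset.mem_filter, Finset.mem_powerset]
    refine ⟨hH.1, hH.2, ?_⟩
    rintro K hKW hK ⟨hHK, hsub⟩
    have hle : G.an H ⊆ G.an K := by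
      intro a ha
      obtain ⟨b, hb, hab⟩ := G.mem_an.mp ha
      obtain ⟨c, hc, hbc⟩ := G.mem_an.mp (hsub hb)
      exact G.mem_an.mpr ⟨c, hc, hab.trans hbc⟩
    have heq : G.an H = G.an K := Finset.eq_of_subset_of_card_le hle (hmax K ⟨hKW, hK⟩)
    have hK' : K ⊆ G.an H := by
      rw [heq]
      exact fun a ha => G.mem_an.mpr ⟨a, ha, Relation.ReflTransGen.refl⟩
    exact hHK (Finset.Subset.antisymm (G.head_antisymm hH.2 hsub hK')
      (G.head_antisymm hK hK' hsub))
  obtain ⟨w, hw⟩ := hH.2.1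
  refine Finset.ssubset_iff_subset_ne.mpr ⟨Finset.sdiff_subset, fun h => ?_⟩
  have h1 : w ∈ G.rest W := by rw [h]; exact hH.1 hw
  exact (Finset.mem_sdiff.mp h1).2 (Finset.mem_biUnion.mpr ⟨H, hmem, hw⟩)

/-- The partitioning function: `[∅] = ∅` and `[W] = Φ(W) ∪ [ψ(W)]` for non-empty `W`. -/
noncomputable def part (W : Finset V) : Finset (Finset V) :=
  if h : W.Nonempty then G.maxHeads W ∪ part (G.rest W) else ∅
termination_by W.card
decreasing_by exact Finset.card_lt_card (G.rest_ssubset h)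

end Heads

end ADMG

/-- The event `X_A = x_A` in `{0,1}^V`; only the coordinates of `x` in `A` matter. -/
def coordEvent {V : Type*} (A : Finset V) (x : V → Fin 2) : Set (V → Fin 2) :=
  {y | ∀ v ∈ A, y v = x v}

/-- The event `X_H = 0`. -/
def zeroEvent {V : Type*} (H : Finset V) : Set (V → Fin 2) :=
  {y | ∀ v ∈ H, y v = 0}

/-- The global Markov property of a probability distribution on `{0,1}^V` for the graph `G`:
m-separation of `A` and `B` given `C` implies that `X_A` and `X_B` are conditionally independent
given `X_C`. -/
def ADMG.GlobalMarkov {V : Type*} [Fintype V] (G : ADMG V)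
    (P : Measure (V → Fin 2)) [IsFiniteMeasure P] : Prop :=
  ∀ A B C : Finset V, A.Nonempty → B.Nonempty →
    Disjoint A B → Disjoint A C → Disjoint B C → G.MSep A B C →
    CondIndepFun (MeasurableSpace.comap (Finset.restrict (π := fun _ : V => Fin 2) C) inferInstance)
      (Finset.measurable_restrict (X := fun _ : V => Fin 2) C).comap_le
      (Finset.restrict (π := fun _ : V => Fin 2) A)
      (Finset.restrict (π := fun _ : V => Fin 2) B) P

/-- The conditional probability `P(X_H = 0 | X_T = x_T)`; it is meaningful when
`P(X_T = x_T) > 0`. -/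
noncomputable def condZero {V : Type*} (P : Measure (V → Fin 2))
    (H T : Finset V) (x : V → Fin 2) : ℝ :=
  (ProbabilityTheory.cond P (coordEvent T x)).real (zeroEvent H)

set_option linter.unusedSectionVars false

namespace ADMG

theorem union_sdiff_union_of_disjoint {α : Type*} [DecidableEq α] {W₁ W₂ U₁ U₂ : Finset α}
    (hd : Disjoint W₁ W₂) (h₁ : U₁ ⊆ W₁) (h₂ : U₂ ⊆ W₂) :
    (W₁ ∪ W₂) \ (U₁ ∪ U₂) = (W₁ \ U₁) ∪ (W₂ \ U₂) := by
  ext v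
  have a1 := @h₁ v
  have a2 := @h₂ v
  have a3 : v ∈ W₁ → v ∉ W₂ := fun h => Finset.disjoint_left.mp hd h
  simp only [Finset.mem_sdiff, Finset.mem_union]
  tauto

section Graph

variable {V : Type*} [Fintype V] [DecidableEq V] (G : ADMG V)

theorem mem_pa {W : Finset V} {w : V} : w ∈ G.pa W ↔ ∃ v ∈ W, G.dir w v := by
  simp [pa]

theorem mem_dis {A W : Finset V} {w : V} :
    w ∈ G.dis A W ↔
      ∃ v ∈ W, Relation.ReflTransGen (fun a b => a ∈ A ∧ b ∈ A ∧ G.bi a b) v w := by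
  simp [dis]

theorem subset_an (W : Finset V) : W ⊆ G.an W :=
  fun w hw => G.mem_an.mpr ⟨w, hw, Relation.ReflTransGen.refl⟩

theorem an_mono {W W' : Finset V} (h : W ⊆ W') : G.an W ⊆ G.an W' := by
  intro a ha
  obtain ⟨b, hb, hab⟩ := G.mem_an.mp ha
  exact G.mem_an.mpr ⟨b, h hb, hab⟩

theorem mem_an_of_anc {W : Finset V} {v w : V} (h : G.Anc v w) (hw : w ∈ G.an W) :
    v ∈ G.an W := by
  obtain ⟨b, hb, hab⟩ := G.mem_an.mp hw
  exact G.mem_an.mpr ⟨b, hb, h.trans hab⟩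

theorem an_subset_an {W W' : Finset V} (h : W ⊆ G.an W') : G.an W ⊆ G.an W' := by
  intro a ha
  obtain ⟨b, hb, hab⟩ := G.mem_an.mp ha
  exact G.mem_an_of_anc hab (h hb)

theorem isAncestral_an (W : Finset V) : G.IsAncestral (G.an W) :=
  Finset.Subset.antisymm (G.an_subset_an (Finset.Subset.refl _)) (G.subset_an _)

variable {G} in
theorem IsAncestral.mem {A : Finset V} (hA : G.IsAncestral A) {v w : V} (h : G.Anc v w)
    (hw : w ∈ A) : v ∈ A := by
  rw [← hA]
  exact G.mem_an.mpr ⟨w, hw, h⟩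

theorem isAncestral_of_forall {A : Finset V} (h : ∀ v w, G.Anc v w → w ∈ A → v ∈ A) :
    G.IsAncestral A := by
  refine Finset.Subset.antisymm (fun a ha => ?_) (G.subset_an A)
  obtain ⟨b, hb, hab⟩ := G.mem_an.mp ha
  exact h a b hab hb

variable {G} in
theorem IsAncestral.an_subset {A W : Finset V} (hA : G.IsAncestral A) (h : W ⊆ A) :
    G.an W ⊆ A := by
  have h1 := G.an_mono h
  rwa [hA] at h1

variable {G} in
theorem IsAncestral.pa_subset {A W : Finset V} (hA : G.IsAncestral A) (h : W ⊆ A) :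
    G.pa W ⊆ A := by
  intro v hv
  obtain ⟨w, hw, hvw⟩ := G.mem_pa.mp hv
  exact hA.mem (Relation.ReflTransGen.single hvw) (h hw)

theorem pa_mono {W W' : Finset V} (h : W ⊆ W') : G.pa W ⊆ G.pa W' := by
  intro a ha
  obtain ⟨b, hb, hab⟩ := G.mem_pa.mp ha
  exact G.mem_pa.mpr ⟨b, h hb, hab⟩

theorem dir_irrefl (v : V) : ¬ G.dir v v := fun h => G.acyclic v (Relation.TransGen.single h)

theorem mem_barren {B : Finset V} {v : V} :
    v ∈ G.barren B ↔ v ∈ B ∧ ∀ w ∈ B, G.Anc v w → w = v := by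
  simp only [barren, Finset.mem_filter, and_congr_right_iff]
  intro hv
  constructor
  · intro h w hw hvw
    have : w ∈ G.de {v} ∩ B := by simp [de, hw, hvw]
    rw [h] at this
    exact Finset.mem_singleton.mp this
  · intro h
    ext w
    simp only [de, Finset.mem_inter, Finset.mem_filter, Finset.mem_univ, true_and,
      Finset.mem_singleton, exists_eq_left]
    constructor
    · rintro ⟨h1, h2⟩
      exact h w h2 h1
    · rintro rfl
      exact ⟨Relation.ReflTransGen.refl, hv⟩

theorem barren_subset (B : Finset V) : G.barren B ⊆ B := Finset.filter_subset _ _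

theorem subset_an_barren (B : Finset V) : B ⊆ G.an (G.barren B) := by
  classical
  intro v hv
  have hne : (B.filter fun w => G.Anc v w).Nonempty :=
    ⟨v, by simpa using ⟨hv, Relation.ReflTransGen.refl⟩⟩
  obtain ⟨w, hw, hmin⟩ := Finset.exists_min_image _ (fun w => (G.de {w}).card) hne
  simp only [Finset.mem_filter] at hw hmin
  refine G.mem_an.mpr ⟨w, G.mem_barren.mpr ⟨hw.1, fun u hu hwu => ?_⟩, hw.2⟩
  have hle : G.de {u} ⊆ G.de {w} := by
    intro t ht
    simp only [de, Finset.mem_filter, Finset.mem_univ, true_and, Finset.mem_singleton,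
      exists_eq_left] at ht ⊢
    exact hwu.trans ht
  have heq := Finset.eq_of_subset_of_card_le hle (hmin u ⟨hu, hw.2.trans hwu⟩)
  have h1 : w ∈ G.de {u} := by
    rw [heq]
    simp only [de, Finset.mem_filter, Finset.mem_univ, true_and, Finset.mem_singleton,
      exists_eq_left]
    exact Relation.ReflTransGen.refl
  simp only [de, Finset.mem_filter, Finset.mem_univ, true_and, Finset.mem_singleton,
      exists_eq_left] at h1
  exact G.anc_antisymm h1 hwu

theorem an_barren (B : Finset V) : G.an (G.barren B) = G.an B :=
  Finset.Subset.antisymm (G.an_mono (G.barren_subset B))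
    (G.an_subset_an (G.subset_an_barren B))

theorem barren_barren (B : Finset V) : G.barren (G.barren B) = G.barren B := by
  refine Finset.Subset.antisymm (G.barren_subset _) fun v hv => ?_
  exact G.mem_barren.mpr ⟨hv, fun w hw => (G.mem_barren.mp hv).2 w (G.barren_subset B hw)⟩

theorem barren_nonempty {B : Finset V} (h : B.Nonempty) : (G.barren B).Nonempty := by
  obtain ⟨v, hv⟩ := h
  obtain ⟨w, hw, -⟩ := G.mem_an.mp (G.subset_an_barren B hv)
  exact ⟨w, hw⟩

theorem biConn_symm {A : Finset V} {v w : V}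
    (h : Relation.ReflTransGen (fun a b => a ∈ A ∧ b ∈ A ∧ G.bi a b) v w) :
    Relation.ReflTransGen (fun a b => a ∈ A ∧ b ∈ A ∧ G.bi a b) w v := by
  have : Std.Symm (fun a b => a ∈ A ∧ b ∈ A ∧ G.bi a b) :=
    ⟨fun _ _ h => ⟨h.2.1, h.1, G.bi_symm _ _ h.2.2⟩⟩
  exact Std.Symm.symm _ _ h

theorem biConn_mono {A B : Finset V} (hAB : A ⊆ B) {v w : V}
    (h : Relation.ReflTransGen (fun a b => a ∈ A ∧ b ∈ A ∧ G.bi a b) v w) :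
    Relation.ReflTransGen (fun a b => a ∈ B ∧ b ∈ B ∧ G.bi a b) v w :=
  Relation.ReflTransGen.mono (fun _ _ h => ⟨hAB h.1, hAB h.2.1, h.2.2⟩) _ _ h

variable {G} in
theorem IsHead.biConn {H : Finset V} (hH : G.IsHead H) {v w : V} (hv : v ∈ H) (hw : w ∈ H) :
    Relation.ReflTransGen (fun a b => a ∈ G.an H ∧ b ∈ G.an H ∧ G.bi a b) v w := by
  obtain ⟨-, -, u, -, hu⟩ := hH
  have h1 := G.mem_dis.mp (hu hv)
  have h2 := G.mem_dis.mp (hu hw)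
  simp only [Finset.mem_singleton, exists_eq_left] at h1 h2
  exact (G.biConn_symm h1).trans h2

theorem isHead_barren_of_biConn {B : Finset V} {u : V} (hu : u ∈ B)
    (h : ∀ w ∈ G.barren B,
      Relation.ReflTransGen (fun a b => a ∈ G.an B ∧ b ∈ G.an B ∧ G.bi a b) u w) :
    G.IsHead (G.barren B) := by
  refine ⟨G.barren_nonempty ⟨u, hu⟩, G.barren_barren B, u, G.subset_an_barren B hu, ?_⟩
  intro w hw
  rw [an_barren]
  exact G.mem_dis.mpr ⟨u, Finset.mem_singleton_self u, h w hw⟩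

theorem mem_maxHeads {W H : Finset V} :
    H ∈ G.maxHeads W ↔ H ⊆ W ∧ G.IsHead H ∧ ∀ K ⊆ W, G.IsHead K → ¬ G.Prec H K := by
  simp [maxHeads]

theorem disjoint_of_mem_maxHeads {W H K : Finset V} (hH : H ∈ G.maxHeads W)
    (hK : K ∈ G.maxHeads W) (hne : H ≠ K) : Disjoint H K := by
  by_contra hd
  obtain ⟨u, huH, huK⟩ := Finset.not_disjoint_iff.mp hd
  rw [mem_maxHeads] at hH hK
  have hL : G.IsHead (G.barren (H ∪ K)) := by
    refine G.isHead_barren_of_biConn (Finset.mem_union_left _ huH) fun w hw => ?_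
    rcases Finset.mem_union.mp (G.barren_subset _ hw) with h | h
    · exact G.biConn_mono (G.an_mono Finset.subset_union_left) (hH.2.1.biConn huH h)
    · exact G.biConn_mono (G.an_mono Finset.subset_union_right) (hK.2.1.biConn huK h)
  have hLW : G.barren (H ∪ K) ⊆ W :=
    (G.barren_subset _).trans (Finset.union_subset hH.1 hK.1)
  have h1 : H = G.barren (H ∪ K) := by
    by_contra h
    exact hH.2.2 _ hLW hL ⟨h, Finset.subset_union_left.trans (G.subset_an_barren _)⟩
  have h2 : K = G.barren (H ∪ K) := by
    by_contra h
    exact hK.2.2 _ hLW hL ⟨h, Finset.subset_union_right.trans (G.subset_an_barren _)⟩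
  exact hne (h1.trans h2.symm)

theorem mem_maxHeads_of_subset {W W' H : Finset V} (hH : H ∈ G.maxHeads W) (h1 : H ⊆ W')
    (h2 : W' ⊆ W) : H ∈ G.maxHeads W' := by
  rw [mem_maxHeads] at hH ⊢
  exact ⟨h1, hH.2.1, fun K hK => hH.2.2 K (hK.trans h2)⟩

theorem part_empty : G.part ∅ = ∅ := by
  rw [part]
  simp

theorem part_eq (W : Finset V) : G.part W = G.maxHeads W ∪ G.part (G.rest W) := by
  rcases W.eq_empty_or_nonempty with rfl | h
  · have h1 : G.rest ∅ = ∅ := by simp [rest]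
    have h2 : G.maxHeads ∅ = ∅ := by
      refine Finset.eq_empty_of_forall_notMem fun H hH => ?_
      rw [mem_maxHeads] at hH
      obtain ⟨v, hv⟩ := hH.2.1.1
      simpa using hH.1 hv
    rw [h1, h2, part_empty, Finset.empty_union]
  · conv_lhs => rw [part]
    simp [h]

theorem rest_subset (W : Finset V) : G.rest W ⊆ W := Finset.sdiff_subset

theorem mem_part {W H : Finset V} (h : H ∈ G.part W) : H ⊆ W ∧ G.IsHead H := by
  induction W using Finset.strongInduction with
  | H W ih =>
    rcases W.eq_empty_or_nonempty with rfl | hW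
    · simp [part_empty] at h
    · rw [part_eq, Finset.mem_union] at h
      rcases h with h | h
      · rw [mem_maxHeads] at h
        exact ⟨h.1, h.2.1⟩
      · have := ih _ (G.rest_ssubset hW) h
        exact ⟨this.1.trans (G.rest_subset W), this.2⟩

theorem part_eq_of_subset_maxHeads (W : Finset V) {S : Finset (Finset V)}
    (hS : S ⊆ G.maxHeads W) : G.part W = S ∪ G.part (W \ S.biUnion id) := by
  induction W using Finset.strongInduction generalizing S with
  | H W ih =>
    rcases S.eq_empty_or_nonempty with rfl | ⟨K, hK⟩
    · simp
    have hlt : W \ S.biUnion id ⊂ W := by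
      have hK' := G.mem_maxHeads.mp (hS hK)
      obtain ⟨v, hv⟩ := hK'.2.1.1
      refine Finset.ssubset_iff_subset_ne.mpr ⟨Finset.sdiff_subset, fun h => ?_⟩
      have h1 : v ∈ W \ S.biUnion id := by rw [h]; exact hK'.1 hv
      exact (Finset.mem_sdiff.mp h1).2 (Finset.mem_biUnion.mpr ⟨K, hK, hv⟩)
    have hsub : G.maxHeads W \ S ⊆ G.maxHeads (W \ S.biUnion id) := by
      intro H hH
      rw [Finset.mem_sdiff] at hH
      refine G.mem_maxHeads_of_subset hH.1 (fun v hv => ?_) Finset.sdiff_subset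
      refine Finset.mem_sdiff.mpr ⟨(G.mem_maxHeads.mp hH.1).1 hv, fun h => ?_⟩
      obtain ⟨L, hL, hvL⟩ := Finset.mem_biUnion.mp h
      have hne : H ≠ L := fun h => hH.2 (h ▸ hL)
      exact Finset.disjoint_left.mp (G.disjoint_of_mem_maxHeads hH.1 (hS hL) hne) hv hvL
    have hrest : (W \ S.biUnion id) \ (G.maxHeads W \ S).biUnion id = G.rest W := by
      rw [rest, sdiff_sdiff_left, Finset.sup_eq_union, ← Finset.union_biUnion,
        Finset.union_sdiff_of_subset hS]
    rw [ih _ hlt hsub, hrest, ← Finset.union_assoc, Finset.union_sdiff_of_subset hS, ← part_eq]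

theorem part_union {W₁ W₂ : Finset V} (hd : Disjoint W₁ W₂)
    (hW : ∀ H, G.IsHead H → H ⊆ W₁ ∪ W₂ → H ⊆ W₁ ∨ H ⊆ W₂) :
    G.part (W₁ ∪ W₂) = G.part W₁ ∪ G.part W₂ := by
  classical
  induction hn : (W₁ ∪ W₂).card using Nat.strong_induction_on generalizing W₁ W₂ with
  | _ n ih =>
    rcases (W₁ ∪ W₂).eq_empty_or_nonempty with he | hne
    · rw [Finset.union_eq_empty] at he
      simp [he.1, he.2, part_empty]
    set Φ := G.maxHeads (W₁ ∪ W₂) with hΦ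
    set S₁ := Φ.filter (fun H => H ⊆ W₁) with hS₁
    set S₂ := Φ.filter (fun H => H ⊆ W₂) with hS₂
    have h1 : S₁ ⊆ G.maxHeads W₁ := fun H hH =>
      G.mem_maxHeads_of_subset (Finset.mem_filter.mp hH).1 (Finset.mem_filter.mp hH).2
        Finset.subset_union_left
    have h2 : S₂ ⊆ G.maxHeads W₂ := fun H hH =>
      G.mem_maxHeads_of_subset (Finset.mem_filter.mp hH).1 (Finset.mem_filter.mp hH).2
        Finset.subset_union_right
    have hS : Φ = S₁ ∪ S₂ := by
      rw [hS₁, hS₂, ← Finset.filter_or]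
      refine (Finset.filter_true_of_mem fun H hH => ?_).symm
      have := G.mem_maxHeads.mp hH
      exact hW H this.2.1 this.1
    have hsub1 : S₁.biUnion id ⊆ W₁ := by
      refine Finset.biUnion_subset.mpr fun H hH => (Finset.mem_filter.mp hH).2
    have hsub2 : S₂.biUnion id ⊆ W₂ := by
      refine Finset.biUnion_subset.mpr fun H hH => (Finset.mem_filter.mp hH).2
    have hrest : G.rest (W₁ ∪ W₂) = (W₁ \ S₁.biUnion id) ∪ (W₂ \ S₂.biUnion id) := by
      rw [rest, ← hΦ, hS, Finset.union_biUnion, union_sdiff_union_of_disjoint hd hsub1 hsub2]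
    have hlt := Finset.card_lt_card (G.rest_ssubset hne)
    have hrs := G.rest_subset (W₁ ∪ W₂)
    rw [hrest] at hlt hrs
    have key := ih _ (hn ▸ hlt)
      (hd.mono Finset.sdiff_subset Finset.sdiff_subset) (fun H hH hHs => ?_) rfl
    · rw [part_eq, ← hΦ, hS, hrest, key, G.part_eq_of_subset_maxHeads W₁ h1,
        G.part_eq_of_subset_maxHeads W₂ h2]
      ext H
      simp only [Finset.mem_union]
      tauto
    · rcases hW H hH (hHs.trans hrs) with h | h
      · left
        intro v hv
        rcases Finset.mem_union.mp (hHs hv) with h' | h'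
        · exact h'
        · exact absurd (Finset.mem_sdiff.mp h').1 (Finset.disjoint_left.mp hd (h hv))
      · right
        intro v hv
        rcases Finset.mem_union.mp (hHs hv) with h' | h'
        · exact absurd (h hv) (Finset.disjoint_left.mp hd (Finset.mem_sdiff.mp h').1)
        · exact h'

/-- Two disjoint sets with ancestral union that are not joined by a bidirected edge. -/
structure Splits (A₁ A₂ : Finset V) : Prop where
  ancestral : G.IsAncestral (A₁ ∪ A₂)
  disjoint : Disjoint A₁ A₂
  not_bi : ∀ a ∈ A₁, ∀ b ∈ A₂, ¬ G.bi a b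

variable {G}

theorem Splits.symm {A₁ A₂ : Finset V} (h : G.Splits A₁ A₂) : G.Splits A₂ A₁ :=
  ⟨by rw [Finset.union_comm]; exact h.ancestral, h.disjoint.symm,
    fun a ha b hb hab => h.not_bi b hb a ha (G.bi_symm _ _ hab)⟩

theorem Splits.mem_of_biConn {A₁ A₂ B : Finset V} (h : G.Splits A₁ A₂) (hB : B ⊆ A₁ ∪ A₂)
    {v w : V} (hvw : Relation.ReflTransGen (fun a b => a ∈ B ∧ b ∈ B ∧ G.bi a b) v w)
    (hv : v ∈ A₁) : w ∈ A₁ := by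
  induction hvw with
  | refl => exact hv
  | tail _ hbc ih =>
    rcases Finset.mem_union.mp (hB hbc.2.1) with h' | h'
    · exact h'
    · exact absurd hbc.2.2 (h.not_bi _ ih _ h')

theorem Splits.head_subset {A₁ A₂ H : Finset V} (h : G.Splits A₁ A₂) (hH : G.IsHead H)
    (hs : H ⊆ A₁ ∪ A₂) : H ⊆ A₁ ∨ H ⊆ A₂ := by
  obtain ⟨u, hu⟩ := hH.1
  have hB := h.ancestral.an_subset hs
  rcases Finset.mem_union.mp (hs hu) with h' | h'
  · exact Or.inl fun w hw => h.mem_of_biConn hB (hH.biConn hu hw) h'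
  · exact Or.inr fun w hw =>
      h.symm.mem_of_biConn (by rwa [Finset.union_comm]) (hH.biConn hu hw) h'

theorem Splits.tail_subset {A₁ A₂ H : Finset V} (h : G.Splits A₁ A₂)
    (hs : H ⊆ A₁) : G.tail H ⊆ A₁ ∪ G.pa A₁ := by
  have hB := h.ancestral.an_subset (hs.trans Finset.subset_union_left)
  have hdis : G.dis (G.an H) H ⊆ A₁ := by
    intro w hw
    obtain ⟨v, hv, hvw⟩ := G.mem_dis.mp hw
    exact h.mem_of_biConn hB hvw (hs hv)
  exact Finset.union_subset_union (Finset.sdiff_subset.trans hdis) (G.pa_mono hdis)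

theorem Splits.part_union {A₁ A₂ C₁ C₂ : Finset V} (h : G.Splits A₁ A₂) (h₁ : C₁ ⊆ A₁)
    (h₂ : C₂ ⊆ A₂) : G.part (C₁ ∪ C₂) = G.part C₁ ∪ G.part C₂ := by
  refine G.part_union (h.disjoint.mono h₁ h₂) fun H hH hHs => ?_
  rcases h.head_subset hH (hHs.trans (Finset.union_subset_union h₁ h₂)) with h' | h'
  · left
    intro v hv
    rcases Finset.mem_union.mp (hHs hv) with h3 | h3
    · exact h3
    · exact absurd (h₂ h3) (Finset.disjoint_left.mp h.disjoint (h' hv))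
  · right
    intro v hv
    rcases Finset.mem_union.mp (hHs hv) with h3 | h3
    · exact absurd (h' hv) (Finset.disjoint_left.mp h.disjoint (h₁ h3))
    · exact h3

theorem Splits.disjoint_part {A₁ A₂ C₁ C₂ : Finset V} (h : G.Splits A₁ A₂) (h₁ : C₁ ⊆ A₁)
    (h₂ : C₂ ⊆ A₂) : Disjoint (G.part C₁) (G.part C₂) := by
  refine Finset.disjoint_left.mpr fun H hH hH' => ?_
  have h3 := G.mem_part hH
  have h4 := G.mem_part hH'
  obtain ⟨v, hv⟩ := h3.2.1
  exact Finset.disjoint_left.mp h.disjoint (h₁ (h3.1 hv)) (h₂ (h4.1 hv))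

end Graph

end ADMG

theorem coordEvent_congr {V : Type*} {A : Finset V} {x y : V → Fin 2}
    (h : ∀ v ∈ A, x v = y v) : coordEvent A x = coordEvent A y := by
  ext z
  simp only [coordEvent, Set.mem_ofPred_eq]
  exact forall₂_congr fun v hv => by rw [h v hv]

theorem coordEvent_anti {V : Type*} {A B : Finset V} (h : A ⊆ B) (x : V → Fin 2) :
    coordEvent B x ⊆ coordEvent A x := fun _ hy v hv => hy v (h hv)

theorem mem_coordEvent_self {V : Type*} (A : Finset V) (x : V → Fin 2) : x ∈ coordEvent A x :=
  fun _ _ => rfl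

namespace ADMG

variable {V : Type*} [Fintype V] [DecidableEq V] (G : ADMG V) (P : Measure (V → Fin 2))

/-- The elements of `W` at which `x` vanishes. -/
def zeros (W : Finset V) (x : V → Fin 2) : Finset V := W.filter fun v => x v = 0

/-- All conditional probabilities in the alternating sum for `W` and `x` are defined. -/
def TailsPos (W : Finset V) (x : V → Fin 2) : Prop :=
  ∀ C : Finset V, zeros W x ⊆ C → C ⊆ W → ∀ H ∈ G.part C, 0 < P (coordEvent (G.tail H) x)

/-- The alternating sum of products of conditional probabilities attached to `W` and `x`. -/
noncomputable def altSum (W : Finset V) (x : V → Fin 2) : ℝ :=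
  ∑ C ∈ Finset.Icc (zeros W x) W, (-1 : ℝ) ^ (C \ zeros W x).card *
    ∏ H ∈ G.part C, condZero P H (G.tail H) x

open Classical in
/-- The alternating sum, or `0` if some conditional probability in it is undefined. -/
noncomputable def guardedSum (W : Finset V) (x : V → Fin 2) : ℝ :=
  if G.TailsPos P W x then G.altSum P W x else 0

theorem mem_zeros {W : Finset V} {x : V → Fin 2} {v : V} :
    v ∈ zeros W x ↔ v ∈ W ∧ x v = 0 := Finset.mem_filter

theorem zeros_subset (W : Finset V) (x : V → Fin 2) : zeros W x ⊆ W := Finset.filter_subset _ _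

theorem zeros_union (W₁ W₂ : Finset V) (x : V → Fin 2) :
    zeros (W₁ ∪ W₂) x = zeros W₁ x ∪ zeros W₂ x := Finset.filter_union _ _ _

variable {G}

theorem guardedSum_of_pos {W : Finset V} {x : V → Fin 2} (h : G.TailsPos P W x) :
    G.guardedSum P W x = G.altSum P W x := if_pos h

theorem guardedSum_of_not {W : Finset V} {x : V → Fin 2} (h : ¬ G.TailsPos P W x) :
    G.guardedSum P W x = 0 := if_neg h

theorem Splits.altSum_union {A₁ A₂ : Finset V} (h : G.Splits A₁ A₂) (x : V → Fin 2) :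
    G.altSum P (A₁ ∪ A₂) x = G.altSum P A₁ x * G.altSum P A₂ x := by
  have z1 := zeros_subset A₁ x
  have z2 := zeros_subset A₂ x
  have hd : ∀ v, v ∈ A₁ → v ∉ A₂ := fun v h' => Finset.disjoint_left.mp h.disjoint h'
  simp only [altSum]
  rw [Finset.sum_mul_sum, ← Finset.sum_product']
  symm
  refine Finset.sum_nbij' (fun C => C.1 ∪ C.2) (fun C => (C ∩ A₁, C ∩ A₂)) ?_ ?_ ?_ ?_ ?_
  · rintro ⟨C₁, C₂⟩ hC
    simp only [Finset.mem_product, Finset.mem_Icc] at hC ⊢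
    rw [zeros_union]
    exact ⟨Finset.union_subset_union hC.1.1 hC.2.1, Finset.union_subset_union hC.1.2 hC.2.2⟩
  · intro C hC
    simp only [Finset.mem_product, Finset.mem_Icc] at hC ⊢
    rw [zeros_union] at hC
    exact ⟨⟨Finset.subset_inter (Finset.subset_union_left.trans hC.1) z1,
      Finset.inter_subset_right⟩,
      ⟨Finset.subset_inter (Finset.subset_union_right.trans hC.1) z2, Finset.inter_subset_right⟩⟩
  · rintro ⟨C₁, C₂⟩ hC
    simp only [Finset.mem_product, Finset.mem_Icc] at hC
    simp only [Prod.mk.injEq]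
    constructor
    · ext v
      have a1 := @hC.1.2 v
      have a2 := @hC.2.2 v
      have a3 := hd v
      simp only [Finset.mem_inter, Finset.mem_union]
      tauto
    · ext v
      have a1 := @hC.1.2 v
      have a2 := @hC.2.2 v
      have a3 := hd v
      simp only [Finset.mem_inter, Finset.mem_union]
      tauto
  · intro C hC
    simp only [Finset.mem_Icc] at hC
    rw [← Finset.inter_union_distrib_left]
    exact Finset.inter_eq_left.mpr hC.2
  · rintro ⟨C₁, C₂⟩ hC
    simp only [Finset.mem_product, Finset.mem_Icc] at hC
    rw [h.part_union hC.1.2 hC.2.2, Finset.prod_union (h.disjoint_part hC.1.2 hC.2.2),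
      zeros_union, union_sdiff_union_of_disjoint (h.disjoint.mono hC.1.2 hC.2.2) hC.1.1 hC.2.1,
      Finset.card_union_of_disjoint ((h.disjoint.mono hC.1.2 hC.2.2).mono
        Finset.sdiff_subset Finset.sdiff_subset), pow_add]
    ring

theorem Splits.tailsPos_union {A₁ A₂ : Finset V} (h : G.Splits A₁ A₂) (x : V → Fin 2) :
    G.TailsPos P (A₁ ∪ A₂) x ↔ G.TailsPos P A₁ x ∧ G.TailsPos P A₂ x := by
  constructor
  · intro hp
    refine ⟨fun C hC hC' H hH => hp (C ∪ A₂) ?_ ?_ H ?_, fun C hC hC' H hH =>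
      hp (A₁ ∪ C) ?_ ?_ H ?_⟩
    · rw [zeros_union]
      exact Finset.union_subset_union hC (zeros_subset _ _)
    · exact Finset.union_subset_union hC' (Finset.Subset.refl _)
    · rw [h.part_union hC' (Finset.Subset.refl _)]
      exact Finset.mem_union_left _ hH
    · rw [zeros_union]
      exact Finset.union_subset_union (zeros_subset _ _) hC
    · exact Finset.union_subset_union (Finset.Subset.refl _) hC'
    · rw [h.part_union (Finset.Subset.refl _) hC']
      exact Finset.mem_union_right _ hH
  · rintro ⟨h1, h2⟩ C hC hC' H hH
    rw [zeros_union] at hC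
    have hCe : C = (C ∩ A₁) ∪ (C ∩ A₂) := by
      rw [← Finset.inter_union_distrib_left]
      exact (Finset.inter_eq_left.mpr hC').symm
    rw [hCe, h.part_union Finset.inter_subset_right Finset.inter_subset_right,
      Finset.mem_union] at hH
    rcases hH with hH | hH
    · exact h1 _ (Finset.subset_inter (Finset.subset_union_left.trans hC) (zeros_subset _ _))
        Finset.inter_subset_right H hH
    · exact h2 _ (Finset.subset_inter (Finset.subset_union_right.trans hC) (zeros_subset _ _))
        Finset.inter_subset_right H hH

theorem Splits.guardedSum_union {A₁ A₂ : Finset V} (h : G.Splits A₁ A₂) (x : V → Fin 2) :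
    G.guardedSum P (A₁ ∪ A₂) x = G.guardedSum P A₁ x * G.guardedSum P A₂ x := by
  have h3 := h.tailsPos_union P x
  by_cases h1 : G.TailsPos P A₁ x
  · by_cases h2 : G.TailsPos P A₂ x
    · rw [guardedSum_of_pos P (h3.mpr ⟨h1, h2⟩), guardedSum_of_pos P h1, guardedSum_of_pos P h2,
        h.altSum_union]
    · rw [guardedSum_of_not P (fun h' => h2 (h3.mp h').2), guardedSum_of_not P h2, mul_zero]
  · rw [guardedSum_of_not P (fun h' => h1 (h3.mp h').1), guardedSum_of_not P h1, zero_mul]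

variable {P} in
theorem tailsPos_of_tail_agree {W : Finset V} {x y : V → Fin 2} (hW : ∀ v ∈ W, x v = y v)
    (ht : ∀ H ⊆ W, G.IsHead H → ∀ v ∈ G.tail H, x v = y v) (hp : G.TailsPos P W x) :
    G.TailsPos P W y := by
  intro C hC hC' H hH
  have h1 := G.mem_part hH
  rw [← coordEvent_congr (ht H (h1.1.trans hC') h1.2)]
  refine hp C ?_ hC' H hH
  intro v hv
  rw [mem_zeros] at hv
  exact hC (mem_zeros.mpr ⟨hv.1, by rw [← hW v hv.1]; exact hv.2⟩)

theorem altSum_congr {W : Finset V} {x y : V → Fin 2} (hW : ∀ v ∈ W, x v = y v)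
    (ht : ∀ H ⊆ W, G.IsHead H → ∀ v ∈ G.tail H, x v = y v) :
    G.altSum P W x = G.altSum P W y := by
  have hz : zeros W x = zeros W y := Finset.filter_congr fun v hv => by rw [hW v hv]
  simp only [altSum, hz]
  refine Finset.sum_congr rfl fun C hC => ?_
  congr 1
  refine Finset.prod_congr rfl fun H hH => ?_
  have h1 := G.mem_part hH
  simp only [condZero,
    coordEvent_congr (ht H (h1.1.trans (Finset.mem_Icc.mp hC).2) h1.2)]

theorem Splits.guardedSum_congr {A₁ A₂ : Finset V} (h : G.Splits A₁ A₂) {x y : V → Fin 2}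
    (hxy : ∀ v ∈ A₁ ∪ G.pa A₁, x v = y v) :
    G.guardedSum P A₁ x = G.guardedSum P A₁ y := by
  have h1 : ∀ v ∈ A₁, x v = y v := fun v hv => hxy v (Finset.mem_union_left _ hv)
  have h2 : ∀ H ⊆ A₁, G.IsHead H → ∀ v ∈ G.tail H, x v = y v :=
    fun H hH _ v hv => hxy v (h.tail_subset hH hv)
  have h3 : G.TailsPos P A₁ x ↔ G.TailsPos P A₁ y :=
    ⟨tailsPos_of_tail_agree h1 h2, tailsPos_of_tail_agree (fun v hv => (h1 v hv).symm)
      (fun H hH hH' v hv => (h2 H hH hH' v hv).symm)⟩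
  by_cases h4 : G.TailsPos P A₁ x
  · rw [guardedSum_of_pos P h4, guardedSum_of_pos P (h3.mp h4), altSum_congr P h1 h2]
  · rw [guardedSum_of_not P h4, guardedSum_of_not P (fun h' => h4 (h3.mpr h'))]

theorem guardedSum_empty [IsProbabilityMeasure P] (x : V → Fin 2) :
    G.guardedSum P ∅ x = 1 := by
  have h : G.TailsPos P ∅ x := by
    intro C _ hC H hH
    rw [Finset.subset_empty.mp hC, part_empty] at hH
    simp at hH
  have hz : zeros ∅ x = ∅ := by simp [zeros]
  simp [guardedSum, h, altSum, hz, part_empty]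

theorem IsAncestral.tail_subset {A H : Finset V} (hA : G.IsAncestral A) (hH : H ⊆ A) :
    G.tail H ⊆ A := by
  have hB := hA.an_subset hH
  have hdis : G.dis (G.an H) H ⊆ A := by
    intro w hw
    obtain ⟨v, hv, hvw⟩ := G.mem_dis.mp hw
    rcases hvw.cases_tail with rfl | ⟨u, -, hu⟩
    · exact hH hv
    · exact hB hu.2.1
  exact Finset.union_subset (Finset.sdiff_subset.trans hdis) (hA.pa_subset hdis)

theorem IsAncestral.tail_subset_sdiff {A H S : Finset V} (hA : G.IsAncestral A) (hH : H ⊆ A)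
    (hS : S ⊆ G.barren A) : G.tail H ⊆ A \ S := by
  intro u hu
  have huA := hA.tail_subset hH hu
  refine Finset.mem_sdiff.mpr ⟨huA, fun huS => ?_⟩
  have hu' := (G.mem_barren.mp (hS huS)).2
  have hB := hA.an_subset hH
  have hdis : G.dis (G.an H) H ⊆ G.an H := by
    intro w hw
    obtain ⟨v, hv, hvw⟩ := G.mem_dis.mp hw
    rcases hvw.cases_tail with rfl | ⟨u, -, hu⟩
    · exact G.subset_an H hv
    · exact hu.2.1
  rcases Finset.mem_union.mp hu with h | h
  · rw [Finset.mem_sdiff] at h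
    obtain ⟨w, hw, huw⟩ := G.mem_an.mp (hdis h.1)
    exact h.2 (hu' w (hH hw) huw ▸ hw)
  · obtain ⟨w, hw, huw⟩ := G.mem_pa.mp h
    have := hu' w (hB (hdis hw)) (Relation.ReflTransGen.single huw)
    subst this
    exact G.dir_irrefl _ huw

/-- A sink takes both values: recursion of the alternating sum at a sink with value `1`. -/
theorem IsAncestral.altSum_sink {A : Finset V} (hA : G.IsAncestral A) {v : V}
    (hv : v ∈ G.barren A) {x : V → Fin 2} (hx : x v = 1) :
    G.altSum P A x = G.altSum P (A.erase v) x - G.altSum P A (Function.update x v 0) := by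
  have hvA := G.barren_subset A hv
  have hvz : v ∉ zeros A x := fun h => by simp [(mem_zeros.mp h).2] at hx
  have hz1 : zeros (A.erase v) x = zeros A x := by
    ext u
    simp only [mem_zeros, Finset.mem_erase]
    constructor
    · tauto
    · rintro ⟨h1, h2⟩
      refine ⟨⟨?_, h1⟩, h2⟩
      rintro rfl
      simp [h2] at hx
  have hz2 : zeros A (Function.update x v 0) = insert v (zeros A x) := by
    ext u
    simp only [mem_zeros, Finset.mem_insert]
    by_cases h : u = v
    · subst h; simp [hvA]
    · simp [h]
  simp only [altSum]
  rw [← Finset.sum_filter_add_sum_filter_not (Finset.Icc (zeros A x) A) (fun C => v ∉ C), hz1,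
    hz2, sub_eq_add_neg, ← Finset.sum_neg_distrib]
  congr 1
  · refine Finset.sum_congr ?_ fun _ _ => rfl
    ext C
    simp only [Finset.mem_filter, Finset.mem_Icc, Finset.subset_erase]
    tauto
  · refine Finset.sum_congr ?_ fun C hC => ?_
    · ext C
      simp only [Finset.mem_filter, Finset.mem_Icc, Finset.insert_subset_iff,
        not_not]
      tauto
    · simp only [Finset.mem_Icc, Finset.insert_subset_iff] at hC
      have hc : C \ zeros A x = insert v (C \ insert v (zeros A x)) := by
        ext u
        simp only [Finset.mem_sdiff, Finset.mem_insert]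
        by_cases h : u = v
        · subst h; simp [hC.1.1, hvz]
        · simp [h]
      rw [hc, Finset.card_insert_of_notMem (by simp), pow_succ]
      have : ∏ H ∈ G.part C, condZero P H (G.tail H) x =
          ∏ H ∈ G.part C, condZero P H (G.tail H) (Function.update x v 0) := by
        refine Finset.prod_congr rfl fun H hH => ?_
        have h1 := G.mem_part hH
        have h2 := hA.tail_subset_sdiff (h1.1.trans hC.2) (Finset.singleton_subset_iff.mpr hv)
        rw [condZero, condZero, coordEvent_congr (y := Function.update x v 0)]
        intro u hu
        have h3 := (Finset.mem_sdiff.mp (h2 hu)).2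
        rw [Function.update_of_ne (by simpa using h3)]
      rw [this]
      ring

theorem IsAncestral.tailsPos_sink {A : Finset V} (hA : G.IsAncestral A) {v : V}
    (hv : v ∈ G.barren A) {x : V → Fin 2} (hx : x v = 1) (hp : G.TailsPos P A x) :
    G.TailsPos P (A.erase v) x ∧ G.TailsPos P A (Function.update x v 0) := by
  constructor
  · intro C hC hC' H hH
    refine hp C (fun u hu => hC ?_) (hC'.trans (Finset.erase_subset _ _)) H hH
    rw [mem_zeros] at hu ⊢
    refine ⟨Finset.mem_erase.mpr ⟨?_, hu.1⟩, hu.2⟩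
    rintro rfl
    simp [hu.2] at hx
  · intro C hC hC' H hH
    have h1 := G.mem_part hH
    have h2 := hA.tail_subset_sdiff (h1.1.trans hC') (Finset.singleton_subset_iff.mpr hv)
    rw [coordEvent_congr (y := x)]
    · refine hp C (fun u hu => hC ?_) hC' H hH
      rw [mem_zeros] at hu ⊢
      refine ⟨hu.1, ?_⟩
      by_cases h : u = v
      · subst h; exact Function.update_self _ _ _
      · rw [Function.update_of_ne h]; exact hu.2
    · intro u hu
      have h3 := (Finset.mem_sdiff.mp (h2 hu)).2
      rw [Function.update_of_ne (by simpa using h3)]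

theorem part_eq_insert {A C S : Finset V} (hS : S ∈ G.maxHeads A) (hSC : S ⊆ C) (hC : C ⊆ A) :
    G.part C = insert S (G.part (C \ S)) ∧ S ∉ G.part (C \ S) := by
  have h1 := G.mem_maxHeads_of_subset hS hSC hC
  constructor
  · rw [G.part_eq_of_subset_maxHeads C (Finset.singleton_subset_iff.mpr h1)]
    rw [Finset.singleton_biUnion, id, Finset.insert_eq]
  · intro h
    have h2 := G.mem_part h
    obtain ⟨u, hu⟩ := h2.2.1
    exact (Finset.mem_sdiff.mp (h2.1 hu)).2 hu

theorem zeros_sdiff (A S : Finset V) (x : V → Fin 2) : zeros (A \ S) x = zeros A x \ S := by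
  ext u
  simp only [mem_zeros, Finset.mem_sdiff]
  tauto

theorem altSum_maxHead {A S : Finset V} (hS : S ∈ G.maxHeads A) {x : V → Fin 2}
    (hx : S ⊆ zeros A x) :
    G.altSum P A x = condZero P S (G.tail S) x * G.altSum P (A \ S) x := by
  simp only [altSum, Finset.mul_sum]
  rw [zeros_sdiff]
  refine Finset.sum_nbij' (fun C => C \ S) (fun C => C ∪ S) ?_ ?_ ?_ ?_ ?_
  · intro C hC
    simp only [Finset.mem_Icc] at hC ⊢
    exact ⟨Finset.sdiff_subset_sdiff hC.1 (Finset.Subset.refl _),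
      Finset.sdiff_subset_sdiff hC.2 (Finset.Subset.refl _)⟩
  · intro C hC
    simp only [Finset.mem_Icc] at hC ⊢
    refine ⟨?_, Finset.union_subset (hC.2.trans Finset.sdiff_subset)
      (hx.trans (zeros_subset _ _))⟩
    rw [← Finset.sdiff_union_of_subset hx]
    exact Finset.union_subset_union hC.1 (Finset.Subset.refl _)
  · intro C hC
    simp only [Finset.mem_Icc] at hC
    exact Finset.sdiff_union_of_subset (hx.trans hC.1)
  · intro C hC
    simp only [Finset.mem_Icc] at hC
    refine Finset.union_sdiff_cancel_right ?_
    exact Finset.disjoint_left.mpr fun u hu hu' => (Finset.mem_sdiff.mp (hC.2 hu)).2 hu'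
  · intro C hC
    simp only [Finset.mem_Icc] at hC
    have h1 := part_eq_insert hS (hx.trans hC.1) hC.2
    rw [h1.1, Finset.prod_insert h1.2]
    have h2 : (C \ S) \ (zeros A x \ S) = C \ zeros A x := by
      ext u
      have := @hx u
      simp only [Finset.mem_sdiff]
      tauto
    rw [h2]
    ring

theorem tailsPos_maxHead {A S : Finset V} (hS : S ∈ G.maxHeads A) {x : V → Fin 2}
    (hx : S ⊆ zeros A x) (hp : G.TailsPos P A x) : G.TailsPos P (A \ S) x := by
  intro C hC hC' H hH
  have hSA := (G.mem_maxHeads.mp hS).1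
  have hd : Disjoint C S :=
    Finset.disjoint_left.mpr fun u hu hu' => (Finset.mem_sdiff.mp (hC' hu)).2 hu'
  have hCA : C ∪ S ⊆ A := Finset.union_subset (hC'.trans Finset.sdiff_subset) hSA
  refine hp (C ∪ S) ?_ hCA H ?_
  · rw [← Finset.sdiff_union_of_subset hx, ← zeros_sdiff]
    exact Finset.union_subset_union hC (Finset.Subset.refl _)
  · rw [(part_eq_insert hS Finset.subset_union_right hCA).1,
      Finset.union_sdiff_cancel_right hd]
    exact Finset.mem_insert_of_mem hH

end ADMG

section Discrete

variable {V : Type*} [Fintype V] [DecidableEq V] (P : Measure (V → Fin 2))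
  [IsFiniteMeasure P]

theorem measurableSet_coordEvent (C : Finset V) (x : V → Fin 2) :
    MeasurableSet (coordEvent C x) := (Set.toFinite _).measurableSet

theorem coordEvent_eq_preimage (C : Finset V) (x : V → Fin 2) :
    coordEvent C x =
      Finset.restrict (π := fun _ : V => Fin 2) C ⁻¹' {Finset.restrict C x} := by
  ext y
  simp only [coordEvent, Set.mem_ofPred_eq, Set.mem_preimage, Set.mem_singleton_iff]
  constructor
  · intro h
    funext v
    exact h v v.2
  · intro h v hv
    exact congrFun h ⟨v, hv⟩

theorem coordEvent_inter (A B : Finset V) (x : V → Fin 2) :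
    coordEvent A x ∩ coordEvent B x = coordEvent (A ∪ B) x := by
  ext y
  simp only [coordEvent, Set.mem_inter_iff, Set.mem_ofPred_eq, Finset.mem_union]
  constructor
  · rintro ⟨h1, h2⟩ v (hv | hv)
    exacts [h1 v hv, h2 v hv]
  · exact fun h => ⟨fun v hv => h v (Or.inl hv), fun v hv => h v (Or.inr hv)⟩

/-- The conditional expectation given finitely many discrete coordinates is the elementary
conditional probability. -/
theorem condExp_restrict_mul_real (C : Finset V) (s : Set (V → Fin 2)) (x : V → Fin 2) :
    (P⟦s | MeasurableSpace.comap (Finset.restrict (π := fun _ : V => Fin 2) C) inferInstance⟧) x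
      * P.real (coordEvent C x) = P.real (s ∩ coordEvent C x) := by
  have hs : MeasurableSet s := (Set.toFinite s).measurableSet
  set m := MeasurableSpace.comap (Finset.restrict (π := fun _ : V => Fin 2) C) inferInstance
    with hm
  have hle := (Finset.measurable_restrict (X := fun _ : V => Fin 2) C).comap_le
  have hF : MeasurableSet[m] (coordEvent C x) :=
    ⟨{Finset.restrict C x}, measurableSet_singleton _, (coordEvent_eq_preimage C x).symm⟩
  have h1 := setIntegral_condExp (μ := P) hle
    ((integrable_const (1 : ℝ)).indicator hs) hF
  have h2 : ∀ y ∈ coordEvent C x, (P⟦s | m⟧) y = (P⟦s | m⟧) x := by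
    intro y hy
    have hmeas : Measurable[m] (P⟦s | m⟧) := stronglyMeasurable_condExp.measurable
    obtain ⟨t, -, ht⟩ := hmeas (measurableSet_singleton ((P⟦s | m⟧) x))
    have hx : x ∈ (P⟦s | m⟧) ⁻¹' {(P⟦s | m⟧) x} := rfl
    rw [← ht] at hx
    have hxy : y ∈ Finset.restrict (π := fun _ : V => Fin 2) C ⁻¹' t := by
      rw [coordEvent_eq_preimage] at hy
      rw [Set.mem_preimage, Set.mem_singleton_iff.mp hy]
      exact hx
    rw [ht] at hxy
    exact hxy
  rw [setIntegral_congr_fun (hle _ hF) h2, setIntegral_const, setIntegral_indicator hs,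
    setIntegral_const] at h1
  rw [Set.inter_comm]
  simpa [mul_comm] using h1

theorem ae_of_forall_real_singleton {p : (V → Fin 2) → Prop}
    (h : ∀ x, 0 < P.real {x} → p x) : ∀ᵐ x ∂P, p x := by
  rw [ae_iff, ← Set.biUnion_of_singleton {a | ¬ p a},
    measure_biUnion_null_iff (Set.toFinite _).countable]
  intro x hx
  by_contra hne
  exact hx (h x ((measureReal_nonneg).lt_of_ne' (by
    rw [Ne, measureReal_eq_zero_iff]; exact hne)))

theorem real_eq_sum (s : Finset (V → Fin 2)) : P.real s = ∑ x ∈ s, P.real {x} := by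
  exact (sum_measureReal_singleton s).symm

theorem exists_mem_real_singleton_pos {s : Set (V → Fin 2)} (h : 0 < P.real s) :
    ∃ x ∈ s, 0 < P.real {x} := by
  classical
  have hs : s = ((Set.toFinite s).toFinset : Set (V → Fin 2)) := by simp
  rw [hs, real_eq_sum] at h
  obtain ⟨x, hx, hp⟩ := Finset.exists_lt_of_sum_lt
    (s := (Set.toFinite s).toFinset) (f := fun _ => (0 : ℝ)) (g := fun x => P.real {x})
    (by simpa only [Finset.sum_const_zero] using h)
  exact ⟨x, by simpa using hx, hp⟩

theorem CondIndepFun.real_coordEvent {A B C : Finset V}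
    (h : CondIndepFun
      (MeasurableSpace.comap (Finset.restrict (π := fun _ : V => Fin 2) C) inferInstance)
      (Finset.measurable_restrict (X := fun _ : V => Fin 2) C).comap_le
      (Finset.restrict (π := fun _ : V => Fin 2) A)
      (Finset.restrict (π := fun _ : V => Fin 2) B) P) (x : V → Fin 2) :
    P.real (coordEvent (A ∪ B ∪ C) x) * P.real (coordEvent C x) =
      P.real (coordEvent (A ∪ C) x) * P.real (coordEvent (B ∪ C) x) := by
  rcases (measureReal_nonneg (μ := P) (s := coordEvent C x)).eq_or_lt with h0 | h0
  · have h1 : P.real (coordEvent (A ∪ C) x) = 0 :=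
      le_antisymm (h0 ▸ measureReal_mono (coordEvent_anti Finset.subset_union_right x))
        measureReal_nonneg
    rw [← h0, h1]
    simp
  · obtain ⟨y, hy, hpos⟩ := exists_mem_real_singleton_pos P h0
    rw [condIndepFun_iff_condExp_inter_preimage_eq_mul
      (Finset.measurable_restrict (X := fun _ : V => Fin 2) A)
      (Finset.measurable_restrict (X := fun _ : V => Fin 2) B)] at h
    have h1 := h {Finset.restrict A x} {Finset.restrict B x} (measurableSet_singleton _)
      (measurableSet_singleton _)
    rw [← coordEvent_eq_preimage, ← coordEvent_eq_preimage] at h1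
    have h2 := condExp_restrict_mul_real P C (coordEvent A x ∩ coordEvent B x) y
    have h3 := condExp_restrict_mul_real P C (coordEvent A x) y
    have h4 := condExp_restrict_mul_real P C (coordEvent B x) y
    have h5 : (P⟦coordEvent A x ∩ coordEvent B x | MeasurableSpace.comap
        (Finset.restrict (π := fun _ : V => Fin 2) C) inferInstance⟧) y =
        (P⟦coordEvent A x | MeasurableSpace.comap
        (Finset.restrict (π := fun _ : V => Fin 2) C) inferInstance⟧) y *
        (P⟦coordEvent B x | MeasurableSpace.comap
        (Finset.restrict (π := fun _ : V => Fin 2) C) inferInstance⟧) y := by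
      by_contra hne
      have h6 := measure_mono_null (s := {y}) (by simpa using hne) (ae_iff.mp h1)
      rw [measureReal_def, h6] at hpos
      simp at hpos
    rw [coordEvent_congr (A := C) (x := y) (y := x) hy] at h2 h3 h4
    rw [show coordEvent A x ∩ coordEvent B x ∩ coordEvent C x = coordEvent (A ∪ B ∪ C) x by
      rw [coordEvent_inter, coordEvent_inter]] at h2
    rw [coordEvent_inter] at h3 h4
    rw [← h2, ← h3, ← h4, h5]
    ring

theorem condIndepFun_of_real_inter {A B C : Finset V}
    (h : ∀ (s : Set (∀ _ : A, Fin 2)) (t : Set (∀ _ : B, Fin 2)) (x : V → Fin 2),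
      P.real ((Finset.restrict A ⁻¹' s ∩ Finset.restrict B ⁻¹' t) ∩ coordEvent C x) *
        P.real (coordEvent C x) =
      P.real (Finset.restrict A ⁻¹' s ∩ coordEvent C x) *
        P.real (Finset.restrict B ⁻¹' t ∩ coordEvent C x)) :
    CondIndepFun
      (MeasurableSpace.comap (Finset.restrict (π := fun _ : V => Fin 2) C) inferInstance)
      (Finset.measurable_restrict (X := fun _ : V => Fin 2) C).comap_le
      (Finset.restrict (π := fun _ : V => Fin 2) A)
      (Finset.restrict (π := fun _ : V => Fin 2) B) P := by
  rw [condIndepFun_iff_condExp_inter_preimage_eq_mul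
      (Finset.measurable_restrict (X := fun _ : V => Fin 2) A)
      (Finset.measurable_restrict (X := fun _ : V => Fin 2) B)]
  intro s t _ _
  refine ae_of_forall_real_singleton P fun x hx => ?_
  have hpos : 0 < P.real (coordEvent C x) :=
    hx.trans_le (measureReal_mono (Set.singleton_subset_iff.mpr (mem_coordEvent_self C x)))
  have h1 := h s t x
  rw [← condExp_restrict_mul_real, ← condExp_restrict_mul_real P C (Finset.restrict A ⁻¹' s),
    ← condExp_restrict_mul_real P C (Finset.restrict B ⁻¹' t)] at h1
  have h2 : P.real (coordEvent C x) * P.real (coordEvent C x) ≠ 0 := by positivity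
  refine mul_right_cancel₀ h2 ?_
  linear_combination h1

end Discrete

namespace ADMG

section Separation

variable {V : Type*} [Fintype V] [DecidableEq V] {G : ADMG V}

theorem EdgeKind.eq_forward_of_not_arrowAtStart {k : EdgeKind} (h : ¬ k.ArrowAtStart) :
    k = .forward := by
  cases k
  · rfl
  · exact absurd trivial h
  · exact absurd trivial h

theorem EdgeKind.eq_backward_of_not_arrowAtEnd {k : EdgeKind} (h : ¬ k.ArrowAtEnd) :
    k = .backward := by
  cases k
  · exact absurd trivial h
  · rfl
  · exact absurd trivial h

theorem Path.vert_mem_of_not_blocked {A C : Finset V} (hA : G.IsAncestral A) (hC : C ⊆ A)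
    {a b : V} (ha : a ∈ A) (hb : b ∈ A) (p : G.Path a b) (hp : ¬ p.Blocked C) :
    ∀ i ≤ p.length, p.vert i ∈ A := by
  have hcol : ∀ i, i + 1 < p.length → p.vert (i + 1) ∉ A → ¬ p.IsCollider i := by
    intro i hi hiA hc
    refine hp (Or.inr ⟨i, hi, hc, ?_⟩)
    rintro ⟨c, hcC, hac⟩
    exact hiA (hA.mem hac (hC hcC))
  have hfwd : ∀ n i, p.length = i + n → i < p.length → p.edge i = .forward →
      p.vert i ∈ A := by
    intro n
    induction n with
    | zero => intro i h h'; omega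
    | succ n ih =>
      intro i h h' he
      have hE := p.hasEdge i h'
      rw [he] at hE
      refine hA.mem (Relation.ReflTransGen.single hE) ?_
      rcases (Nat.succ_le_of_lt h').eq_or_lt with h1 | h1
      · rw [← Nat.succ_eq_add_one, h1, p.vert_length]; exact hb
      · by_contra hni
        have h2 := hcol i h1 hni
        refine hni (ih (i + 1) (by omega) h1 (EdgeKind.eq_forward_of_not_arrowAtStart fun h3 => ?_))
        exact h2 ⟨by rw [he]; trivial, h3⟩
  have hbwd : ∀ i, i < p.length → p.edge i = .backward → p.vert (i + 1) ∈ A := by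
    intro i
    induction i with
    | zero =>
      intro h' he
      have hE := p.hasEdge 0 h'
      rw [he] at hE
      refine hA.mem (Relation.ReflTransGen.single hE) ?_
      rw [p.vert_zero]; exact ha
    | succ i ih =>
      intro h' he
      have hE := p.hasEdge (i + 1) h'
      rw [he] at hE
      refine hA.mem (Relation.ReflTransGen.single hE) ?_
      by_contra hni
      have h2 := hcol i h' hni
      refine hni (ih (by omega) (EdgeKind.eq_backward_of_not_arrowAtEnd fun h3 => ?_))
      exact h2 ⟨h3, by rw [he]; trivial⟩
  intro i hi
  rcases i with _ | i
  · rw [p.vert_zero]; exact ha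
  rcases hi.eq_or_lt with h1 | h1
  · rw [h1, p.vert_length]; exact hb
  by_contra hni
  have h2 := hcol i h1 hni
  by_cases h3 : (p.edge i).ArrowAtEnd
  · have h4 : ¬ (p.edge (i + 1)).ArrowAtStart := fun h => h2 ⟨h3, h⟩
    exact hni (hfwd (p.length - (i + 1)) (i + 1) (by omega) h1
      (EdgeKind.eq_forward_of_not_arrowAtStart h4))
  · exact hni (hbwd i (by omega) (EdgeKind.eq_backward_of_not_arrowAtEnd h3))

theorem Splits.blanket_subset {E F S : Finset V} (h : G.Splits E F)
    (hS : S ⊆ G.barren (E ∪ F)) : (E \ S) ∪ G.pa E ⊆ (E ∪ F) \ S := by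
  refine Finset.union_subset (Finset.sdiff_subset_sdiff Finset.subset_union_left
    (Finset.Subset.refl _)) fun u hu => ?_
  refine Finset.mem_sdiff.mpr ⟨h.ancestral.pa_subset Finset.subset_union_left hu, fun huS => ?_⟩
  obtain ⟨e, he, hue⟩ := G.mem_pa.mp hu
  have := (G.mem_barren.mp (hS huS)).2 e (Finset.mem_union_left _ he)
    (Relation.ReflTransGen.single hue)
  subst this
  exact G.dir_irrefl _ hue

/-- Sinks of a district of an ancestral set are separated from the rest of the set by the other
vertices of the district and the parents of the district. -/
theorem Splits.mSep {E F S : Finset V} (h : G.Splits E F) (hSE : S ⊆ E)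
    (hS : S ⊆ G.barren (E ∪ F)) :
    G.MSep S ((E ∪ F) \ (S ∪ ((E \ S) ∪ G.pa E))) ((E \ S) ∪ G.pa E) := by
  intro s hs d hd p
  by_contra hp
  have hTA := (h.blanket_subset hS).trans Finset.sdiff_subset
  rw [Finset.mem_sdiff, Finset.mem_union (s := S), not_or] at hd
  have hmem := p.vert_mem_of_not_blocked h.ancestral hTA
    (Finset.mem_union_left _ (hSE hs)) hd.1 hp
  have hnc : ∀ i, i + 1 < p.length → p.vert (i + 1) ∈ (E \ S) ∪ G.pa E → p.IsCollider i := by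
    intro i hi hT
    by_contra hc
    exact hp (Or.inl ⟨i, hi, hc, hT⟩)
  have key : ∀ i ≤ p.length, p.vert i ∈ E := by
    intro i
    induction i with
    | zero => intro _; rw [p.vert_zero]; exact hSE hs
    | succ i ih =>
      intro hi
      have hiE := ih (by omega)
      have hE := p.hasEdge i (by omega)
      have hm := hmem (i + 1) hi
      rcases hk : p.edge i with _ | _ | _
      · rw [hk] at hE
        exfalso
        by_cases hiS : p.vert i ∈ S
        · have := (G.mem_barren.mp (hS hiS)).2 _ hm (Relation.ReflTransGen.single hE)
          rw [this] at hE
          exact G.dir_irrefl _ hE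
        · rcases i with _ | i
          · rw [p.vert_zero] at hiS
            exact hiS hs
          · have := (hnc i (by omega)
              (Finset.mem_union_left _ (Finset.mem_sdiff.mpr ⟨hiE, hiS⟩))).2
            rw [hk] at this
            exact this
      · rw [hk] at hE
        exfalso
        have hT : p.vert (i + 1) ∈ (E \ S) ∪ G.pa E :=
          Finset.mem_union_right _ (G.mem_pa.mpr ⟨_, hiE, hE⟩)
        rcases hi.eq_or_lt with h1 | h1
        · rw [h1, p.vert_length] at hT
          exact hd.2.2 hT
        · have := (hnc i h1 hT).1
          rw [hk] at this
          exact this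
      · rw [hk] at hE
        rcases Finset.mem_union.mp hm with h1 | h1
        · exact h1
        · exact absurd hE (h.not_bi _ hiE _ h1)
  have h1 := key p.length le_rfl
  rw [p.vert_length] at h1
  by_cases h2 : d ∈ S
  · exact hd.2.1 h2
  · exact hd.2.2 (Finset.mem_union_left _ (Finset.mem_sdiff.mpr ⟨h1, h2⟩))

theorem IsAncestral.sdiff_barren {A S : Finset V} (hA : G.IsAncestral A) (hS : S ⊆ G.barren A) :
    G.IsAncestral (A \ S) := by
  refine G.isAncestral_of_forall fun v w hvw hw => ?_
  rw [Finset.mem_sdiff] at hw ⊢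
  refine ⟨hA.mem hvw hw.1, fun hv => hw.2 ?_⟩
  rw [(G.mem_barren.mp (hS hv)).2 w hw.1 hvw]
  exact hv

theorem Splits.sdiff_left {E F S : Finset V} (h : G.Splits E F) (hSE : S ⊆ E)
    (hS : S ⊆ G.barren (E ∪ F)) : G.Splits (E \ S) F ∧ (E \ S) ∪ F = (E ∪ F) \ S := by
  have he : (E \ S) ∪ F = (E ∪ F) \ S := by
    ext u
    have h1 : u ∈ F → u ∉ S := fun hF hS => Finset.disjoint_left.mp h.disjoint (hSE hS) hF
    simp only [Finset.mem_union, Finset.mem_sdiff]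
    tauto
  refine ⟨⟨?_, h.disjoint.mono_left Finset.sdiff_subset,
    fun a ha => h.not_bi a (Finset.mem_sdiff.mp ha).1⟩, he⟩
  rw [he]
  exact h.ancestral.sdiff_barren hS

theorem barren_an (E : Finset V) : G.barren (G.an E) = G.barren E := by
  ext v
  rw [mem_barren, mem_barren]
  constructor
  · rintro ⟨h1, h2⟩
    obtain ⟨e, he, hve⟩ := G.mem_an.mp h1
    have := h2 e (G.subset_an E he) hve
    subst this
    exact ⟨he, fun w hw => h2 w (G.subset_an E hw)⟩
  · rintro ⟨h1, h2⟩
    refine ⟨G.subset_an E h1, fun w hw hvw => ?_⟩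
    obtain ⟨e, he, hwe⟩ := G.mem_an.mp hw
    have := h2 e he (hvw.trans hwe)
    subst this
    exact G.anc_antisymm hwe hvw

theorem dis_self_biConn {A : Finset V} {v w : V} (hw : w ∈ G.dis A {v}) :
    Relation.ReflTransGen (fun a b => a ∈ G.dis A {v} ∧ b ∈ G.dis A {v} ∧ G.bi a b) v w := by
  obtain ⟨u, hu, huw⟩ := G.mem_dis.mp hw
  rw [Finset.mem_singleton] at hu
  subst hu
  clear hw
  induction huw with
  | refl => exact Relation.ReflTransGen.refl
  | @tail b c hub hbc ih =>
    refine ih.tail ⟨?_, ?_, hbc.2.2⟩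
    · exact G.mem_dis.mpr ⟨u, Finset.mem_singleton_self u, hub⟩
    · exact G.mem_dis.mpr ⟨u, Finset.mem_singleton_self u, hub.tail hbc⟩

theorem self_mem_dis (A : Finset V) (v : V) : v ∈ G.dis A {v} :=
  G.mem_dis.mpr ⟨v, Finset.mem_singleton_self v, Relation.ReflTransGen.refl⟩

theorem dis_subset {A : Finset V} {v : V} (hv : v ∈ A) : G.dis A {v} ⊆ A := by
  intro w hw
  obtain ⟨u, hu, huw⟩ := G.mem_dis.mp hw
  rw [Finset.mem_singleton] at hu
  subst hu
  rcases huw.cases_tail with rfl | ⟨t, -, ht⟩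
  · exact hv
  · exact ht.2.1

theorem dis_closed {A : Finset V} {v e w : V} (he : e ∈ G.dis A {v}) (heA : e ∈ A)
    (hwA : w ∈ A) (h : G.bi e w) : w ∈ G.dis A {v} := by
  obtain ⟨u, hu, hue⟩ := G.mem_dis.mp he
  exact G.mem_dis.mpr ⟨u, hu, hue.tail ⟨heA, hwA, h⟩⟩

theorem IsAncestral.splits_dis {A : Finset V} (hA : G.IsAncestral A) {v : V} (hv : v ∈ A) :
    G.Splits (G.dis A {v}) (A \ G.dis A {v}) := by
  refine ⟨?_, Finset.disjoint_sdiff, fun a ha b hb hab => ?_⟩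
  · rw [Finset.union_sdiff_of_subset (dis_subset hv)]
    exact hA
  · rw [Finset.mem_sdiff] at hb
    exact hb.2 (dis_closed ha (dis_subset hv ha) hb.1 hab)

theorem barren_mem_maxHeads {E : Finset V} {u : V} (hu : u ∈ E)
    (hconn : ∀ e ∈ E, Relation.ReflTransGen (fun a b => a ∈ E ∧ b ∈ E ∧ G.bi a b) u e) :
    G.barren E ∈ G.maxHeads (G.an E) := by
  have hhead : G.IsHead (G.barren E) := G.isHead_barren_of_biConn hu fun w hw =>
    G.biConn_mono (G.subset_an E) (hconn w (G.barren_subset E hw))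
  refine G.mem_maxHeads.mpr ⟨(G.barren_subset E).trans (G.subset_an E), hhead, ?_⟩
  rintro K hKE hK ⟨hne, hsub⟩
  have hK' : K ⊆ G.an (G.barren E) := by rwa [an_barren]
  exact hne (Finset.Subset.antisymm (G.head_antisymm hhead hsub hK')
    (G.head_antisymm hK hK' hsub))

theorem Splits.tail_barren {E F : Finset V} (h : G.Splits E F) (hEF : G.an E = E ∪ F) {u : V}
    (hconn : ∀ e ∈ E, Relation.ReflTransGen (fun a b => a ∈ E ∧ b ∈ E ∧ G.bi a b) u e)
    (hu : u ∈ E) : G.tail (G.barren E) = (E \ G.barren E) ∪ G.pa E := by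
  have hdis : G.dis (G.an (G.barren E)) (G.barren E) = E := by
    rw [an_barren]
    ext w
    rw [mem_dis]
    constructor
    · rintro ⟨v, hv, hvw⟩
      exact h.mem_of_biConn hEF.le hvw (G.barren_subset E hv)
    · intro hw
      obtain ⟨s, hs⟩ := G.barren_nonempty ⟨u, hu⟩
      exact ⟨s, hs, G.biConn_mono (G.subset_an E)
        ((G.biConn_symm (hconn s (G.barren_subset E hs))).trans (hconn w hw))⟩
  rw [tail, hdis]

end Separation

section Factorization

variable {V : Type*} [Fintype V] [DecidableEq V] {G : ADMG V} (P : Measure (V → Fin 2))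
  [IsProbabilityMeasure P]

theorem GlobalMarkov.real_sinks (hG : G.GlobalMarkov P) {E F S : Finset V} (h : G.Splits E F)
    (hne : S.Nonempty) (hSE : S ⊆ E) (hS : S ⊆ G.barren (E ∪ F)) (x : V → Fin 2) :
    P.real (coordEvent (E ∪ F) x) * P.real (coordEvent ((E \ S) ∪ G.pa E) x) =
      P.real (coordEvent (S ∪ ((E \ S) ∪ G.pa E)) x) *
        P.real (coordEvent ((E ∪ F) \ S) x) := by
  have hT := h.blanket_subset hS
  have hsep := h.mSep hSE hS
  have hST : Disjoint S ((E \ S) ∪ G.pa E) :=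
    Finset.disjoint_sdiff.mono_right hT
  have hSA : S ⊆ E ∪ F := hS.trans (G.barren_subset _)
  have hTA := hT.trans Finset.sdiff_subset
  generalize (E \ S) ∪ G.pa E = T at *
  generalize E ∪ F = A at *
  have e1 : S ∪ (A \ (S ∪ T)) ∪ T = A := by
    rw [Finset.union_right_comm, Finset.union_sdiff_of_subset (Finset.union_subset hSA hTA)]
  have e2 : (A \ (S ∪ T)) ∪ T = A \ S := by
    rw [show A \ (S ∪ T) = (A \ S) \ T from sdiff_sdiff_left.symm]
    exact Finset.sdiff_union_of_subset hT
  rcases (A \ (S ∪ T)).eq_empty_or_nonempty with hD | hD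
  · rw [hD, Finset.union_empty] at e1
    rw [hD, Finset.empty_union] at e2
    rw [← e2, e1]
  · have hci := hG S (A \ (S ∪ T)) T hne hD
      (Finset.disjoint_sdiff.mono_left Finset.subset_union_left) hST
      (Finset.sdiff_disjoint.mono_right Finset.subset_union_right) hsep
    have := CondIndepFun.real_coordEvent P hci x
    rwa [e1, e2] at this

theorem condZero_mul_real {S T : Finset V} {x : V → Fin 2} (hx : ∀ v ∈ S, x v = 0)
    (hT : 0 < P.real (coordEvent T x)) :
    condZero P S T x * P.real (coordEvent T x) = P.real (coordEvent (S ∪ T) x) := by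
  have hz : zeroEvent S = coordEvent S x := by
    ext y
    simp only [zeroEvent, coordEvent, Set.mem_ofPred_eq]
    exact forall₂_congr fun v hv => by rw [hx v hv]
  rw [condZero, measureReal_def, cond_apply (measurableSet_coordEvent T x), hz, Set.inter_comm,
    coordEvent_inter, ENNReal.toReal_mul, ENNReal.toReal_inv, ← measureReal_def,
    ← measureReal_def]
  field_simp

theorem real_coordEvent_erase {A : Finset V} {v : V} (hv : v ∈ A) {x : V → Fin 2}
    (hx : x v = 1) :
    P.real (coordEvent (A \ {v}) x) =
      P.real (coordEvent A x) + P.real (coordEvent A (Function.update x v 0)) := by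
  rw [← measureReal_union _ (measurableSet_coordEvent _ _)]
  · congr 1
    ext y
    simp only [coordEvent, Finset.mem_sdiff, Finset.mem_singleton, Set.mem_ofPred_eq, Set.mem_union]
    constructor
    · intro h
      have h01 : y v = 1 ∨ y v = 0 := by
        generalize y v = t
        fin_cases t <;> simp
      rcases h01 with h1 | h1
      · left
        intro u hu
        by_cases huv : u = v
        · rw [huv, h1, hx]
        · exact h u ⟨hu, huv⟩
      · right
        intro u hu
        by_cases huv : u = v
        · rw [huv, h1, Function.update_self]
        · rw [Function.update_of_ne huv]
          exact h u ⟨hu, huv⟩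
    · rintro (h | h) u ⟨hu, huv⟩
      · exact h u hu
      · rw [h u hu, Function.update_of_ne huv]
  · refine Set.disjoint_left.mpr fun y h1 h2 => ?_
    have h3 := h1 v hv
    rw [h2 v hv, Function.update_self, hx] at h3
    exact absurd h3 (by decide)

theorem IsAncestral.real_coordEvent_of_not_tailsPos {A : Finset V} (hA : G.IsAncestral A)
    {x : V → Fin 2} (h : ¬ G.TailsPos P A x) : P.real (coordEvent A x) = 0 := by
  unfold TailsPos at h
  push Not at h
  obtain ⟨C, -, hC, H, hH, h0⟩ := h
  have h1 := G.mem_part hH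
  have h2 : P (coordEvent (G.tail H) x) = 0 := le_antisymm h0 zero_le
  rw [measureReal_def, measure_mono_null (coordEvent_anti (hA.tail_subset (h1.1.trans hC)) x) h2]
  simp

theorem GlobalMarkov.real_eq_guardedSum_of_an_eq (hG : G.GlobalMarkov P) {E F : Finset V}
    (h : G.Splits E F) (hEF : G.an E = E ∪ F) {u : V} (hu : u ∈ E)
    (hconn : ∀ e ∈ E, Relation.ReflTransGen (fun a b => a ∈ E ∧ b ∈ E ∧ G.bi a b) u e)
    (ih : ∀ x, P.real (coordEvent ((E ∪ F) \ G.barren E) x) =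
      G.guardedSum P ((E ∪ F) \ G.barren E) x)
    {x : V → Fin 2} (hx : ∀ v ∈ G.barren E, x v = 0) (hp : G.TailsPos P (E ∪ F) x) :
    P.real (coordEvent (E ∪ F) x) = G.altSum P (E ∪ F) x := by
  have hS := barren_mem_maxHeads hu hconn
  have htail := h.tail_barren hEF hconn hu
  rw [hEF] at hS
  have hb : G.barren E ⊆ G.barren (E ∪ F) := by rw [← hEF, barren_an]
  have hz : G.barren E ⊆ zeros (E ∪ F) x := fun v hv =>
    mem_zeros.mpr ⟨Finset.mem_union_left _ (G.barren_subset E hv), hx v hv⟩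
  have hpart := (part_eq_insert hS (hz.trans (zeros_subset _ _)) (Finset.Subset.refl _)).1
  have hT : 0 < P.real (coordEvent (G.tail (G.barren E)) x) := by
    have := hp (E ∪ F) (zeros_subset _ _) (Finset.Subset.refl _) (G.barren E)
      (by rw [hpart]; exact Finset.mem_insert_self _ _)
    exact ENNReal.toReal_pos this.ne' (measure_ne_top _ _)
  have h1 := hG.real_sinks P h (G.barren_nonempty ⟨u, hu⟩) (G.barren_subset E) hb x
  have h2 := condZero_mul_real P hx hT
  rw [← htail, ← h2, ih x, guardedSum_of_pos P (tailsPos_maxHead P hS hz hp)] at h1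
  rw [altSum_maxHead P hS hz]
  refine mul_right_cancel₀ hT.ne' ?_
  rw [h1]
  ring

theorem GlobalMarkov.real_eq_guardedSum_of_an_ssubset (hG : G.GlobalMarkov P) {E F : Finset V}
    (h : G.Splits E F) (hEF : G.an E ⊂ E ∪ F) {v : V} (hv : v ∈ E)
    (hvb : v ∈ G.barren (E ∪ F))
    (hconn : ∀ e ∈ E, Relation.ReflTransGen (fun a b => a ∈ E ∧ b ∈ E ∧ G.bi a b) v e)
    (ih : ∀ B ⊂ E ∪ F, G.IsAncestral B → ∀ x, P.real (coordEvent B x) = G.guardedSum P B x)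
    (x : V → Fin 2) : P.real (coordEvent (E ∪ F) x) = G.guardedSum P (E ∪ F) x := by
  obtain ⟨F₀, hF₀, hE₀⟩ : ∃ F₀ ⊆ F, G.an E = E ∪ F₀ := by
    refine ⟨G.an E \ E, fun u hu => ?_,
      (Finset.union_sdiff_of_subset (G.subset_an E)).symm⟩
    rw [Finset.mem_sdiff] at hu
    exact (Finset.mem_union.mp (hEF.1 hu.1)).resolve_left hu.2
  have h₀ : G.Splits E F₀ := ⟨by rw [← hE₀]; exact G.isAncestral_an E,
    h.disjoint.mono_right hF₀, fun a ha b hb => h.not_bi a ha b (hF₀ hb)⟩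
  have hsv : ({v} : Finset V) ⊆ E := Finset.singleton_subset_iff.mpr hv
  have hvb₀ : v ∈ G.barren (E ∪ F₀) := G.mem_barren.mpr ⟨Finset.mem_union_left _ hv,
    fun w hw => (G.mem_barren.mp hvb).2 w (Finset.union_subset_union_right hF₀ hw)⟩
  have hbb : G.barren E = G.barren (E ∪ F₀) := by rw [← hE₀, barren_an]
  have hlt : E ∪ F₀ ⊂ E ∪ F := hE₀ ▸ hEF
  have hd := h.sdiff_left hsv (Finset.singleton_subset_iff.mpr hvb)
  have hd₀ := h₀.sdiff_left hsv (Finset.singleton_subset_iff.mpr hvb₀)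
  have hdS := h₀.sdiff_left (G.barren_subset E) hbb.le
  have hss : (E ∪ F) \ {v} ⊂ E ∪ F := Finset.sdiff_ssubset
    (Finset.singleton_subset_iff.mpr (Finset.mem_union_left _ hv)) (Finset.singleton_nonempty v)
  have ihA := ih _ hlt h₀.ancestral
  have ihv := ih _ hss (hd.2 ▸ hd.1.ancestral)
  have ihv₀ := ih _ (Finset.sdiff_subset.trans_ssubset hlt : (E ∪ F₀) \ {v} ⊂ _)
    (hd₀.2 ▸ hd₀.1.ancestral)
  have ihS := ih _ (Finset.sdiff_subset.trans_ssubset hlt : (E ∪ F₀) \ G.barren E ⊂ _)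
    (hdS.2 ▸ hdS.1.ancestral)
  simp only [← hd.2, hd.1.guardedSum_union] at ihv
  simp only [← hd₀.2, hd₀.1.guardedSum_union] at ihv₀
  simp only [← hdS.2, hdS.1.guardedSum_union] at ihS
  simp only [h₀.guardedSum_union] at ihA
  rw [h.guardedSum_union]
  by_cases hR : G.guardedSum P E x = 0
  · rw [hR, zero_mul]
    have h1 := ihA x
    rw [hR, zero_mul] at h1
    exact le_antisymm (h1 ▸ measureReal_mono (coordEvent_anti hlt.1 x)) measureReal_nonneg
  have hpE : G.TailsPos P E x := by
    by_contra hn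
    exact hR (guardedSum_of_not P hn)
  have hmax := G.mem_maxHeads_of_subset (barren_mem_maxHeads hv hconn) (G.barren_subset E)
    (G.subset_an E)
  have htail := h₀.tail_barren hE₀ hconn hv
  have hT : 0 < P.real (coordEvent (G.tail (G.barren E)) x) := by
    have := hpE E (zeros_subset _ _) (Finset.Subset.refl _) (G.barren E)
      (by rw [G.part_eq]; exact Finset.mem_union_left _ hmax)
    exact ENNReal.toReal_pos this.ne' (measure_ne_top _ _)
  obtain ⟨y, hy, hypos⟩ := exists_mem_real_singleton_pos P hT
  rw [htail] at hy
  set x' : V → Fin 2 := fun w => if w ∈ E ∪ G.pa E then x w else y w with hx'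
  have hxx : ∀ w ∈ E ∪ G.pa E, x' w = x w := fun w hw => by simp only [hx', if_pos hw]
  have hxy : ∀ w ∈ (E \ G.barren E) ∪ F₀, x' w = y w := by
    intro w hw
    by_cases hwE : w ∈ E ∪ G.pa E
    · rw [hxx w hwE]
      refine (hy w ?_).symm
      rw [hdS.2, Finset.mem_sdiff] at hw
      rcases Finset.mem_union.mp hwE with h1 | h1
      · exact Finset.mem_union_left _ (Finset.mem_sdiff.mpr ⟨h1, hw.2⟩)
      · exact Finset.mem_union_right _ h1
    · simp only [hx', if_neg hwE]
  have hpos1 : 0 < P.real (coordEvent ((E \ G.barren E) ∪ F₀) x') := by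
    rw [coordEvent_congr hxy]
    exact hypos.trans_le (measureReal_mono (Set.singleton_subset_iff.mpr
      (mem_coordEvent_self _ y)))
  have hF0 : G.guardedSum P F₀ x' ≠ 0 := by
    intro h0
    rw [ihS x', h0, mul_zero] at hpos1
    exact lt_irrefl _ hpos1
  have hRx : G.guardedSum P E x' = G.guardedSum P E x := h₀.guardedSum_congr P hxx
  have hA0 : P.real (coordEvent (E ∪ F₀) x') ≠ 0 := by
    rw [ihA x', hRx]
    exact mul_ne_zero hR hF0
  have hblk := h₀.blanket_subset (Finset.singleton_subset_iff.mpr hvb₀)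
  have hsub1 : (E \ {v}) ∪ G.pa E ⊆ E ∪ G.pa E :=
    Finset.union_subset_union_left Finset.sdiff_subset
  have hsub2 : {v} ∪ ((E \ {v}) ∪ G.pa E) ⊆ E ∪ G.pa E :=
    Finset.union_subset (hsv.trans Finset.subset_union_left) hsub1
  have hm : P.real (coordEvent ((E \ {v}) ∪ G.pa E) x) ≠ 0 := by
    rw [← coordEvent_congr fun w hw => hxx w (hsub1 hw)]
    intro h0
    exact hA0 (le_antisymm (h0 ▸ measureReal_mono
      (coordEvent_anti (hblk.trans Finset.sdiff_subset) x')) measureReal_nonneg)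
  have hEv : G.guardedSum P (E \ {v}) x' = G.guardedSum P (E \ {v}) x :=
    hd₀.1.guardedSum_congr P fun w hw => hxx w
      (Finset.union_subset_union Finset.sdiff_subset (G.pa_mono Finset.sdiff_subset) hw)
  have c0 := hG.real_sinks P h₀ (Finset.singleton_nonempty v) hsv
    (Finset.singleton_subset_iff.mpr hvb₀) x'
  have c1 := hG.real_sinks P h (Finset.singleton_nonempty v) hsv
    (Finset.singleton_subset_iff.mpr hvb) x
  rw [coordEvent_congr (fun w hw => hxx w (hsub1 hw)),
    coordEvent_congr (fun w hw => hxx w (hsub2 hw)), ihA, ← hd₀.2, ihv₀, hRx, hEv] at c0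
  rw [← hd.2, ihv] at c1
  have c2 : G.guardedSum P E x * P.real (coordEvent ((E \ {v}) ∪ G.pa E) x) =
      P.real (coordEvent ({v} ∪ ((E \ {v}) ∪ G.pa E)) x) * G.guardedSum P (E \ {v}) x :=
    mul_right_cancel₀ hF0 (by linear_combination c0)
  refine mul_right_cancel₀ hm ?_
  rw [c1]
  linear_combination (-G.guardedSum P F x) * c2

theorem GlobalMarkov.real_eq_guardedSum (hG : G.GlobalMarkov P) (A : Finset V)
    (hA : G.IsAncestral A) (x : V → Fin 2) :
    P.real (coordEvent A x) = G.guardedSum P A x := by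
  induction A using Finset.strongInduction generalizing x with
  | H A ih =>
    rcases A.eq_empty_or_nonempty with rfl | hne
    · rw [guardedSum_empty]
      have : coordEvent (∅ : Finset V) x = Set.univ := by
        ext y; simp [coordEvent]
      rw [this]
      simp
    induction hn : (A.filter fun v => x v = 1).card using Nat.strong_induction_on
      generalizing x with
    | _ n ihn =>
      by_cases hp : G.TailsPos P A x
      swap
      · rw [guardedSum_of_not P hp, hA.real_coordEvent_of_not_tailsPos P hp]
      by_cases h1 : ∃ v ∈ G.barren A, x v = 1
      · obtain ⟨v, hv, hxv⟩ := h1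
        have hvA := G.barren_subset A hv
        have hs := hA.altSum_sink P hv hxv
        obtain ⟨p1, p2⟩ := hA.tailsPos_sink P hv hxv hp
        have hr := real_coordEvent_erase P hvA hxv
        have i1 := ih (A \ {v}) (Finset.sdiff_ssubset (Finset.singleton_subset_iff.mpr hvA)
          (Finset.singleton_nonempty v))
          (hA.sdiff_barren (Finset.singleton_subset_iff.mpr hv)) x
        have hcard : (A.filter fun u => Function.update x v 0 u = 1).card < n := by
          rw [← hn]
          refine Finset.card_lt_card (Finset.ssubset_iff_subset_ne.mpr ⟨fun u hu => ?_, ?_⟩)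
          · rw [Finset.mem_filter] at hu ⊢
            refine ⟨hu.1, ?_⟩
            by_cases huv : u = v
            · rw [huv, hxv]
            · rw [← hu.2, Function.update_of_ne huv]
          · intro heq
            have : v ∈ A.filter fun u => Function.update x v 0 u = 1 := by
              rw [heq]
              exact Finset.mem_filter.mpr ⟨hvA, hxv⟩
            simp at this
        have i2 := ihn _ hcard (Function.update x v 0) rfl
        rw [Finset.sdiff_singleton_eq_erase] at i1 hr
        rw [guardedSum_of_pos P p1] at i1
        rw [guardedSum_of_pos P p2] at i2
        rw [guardedSum_of_pos P hp, hs, ← i1, ← i2, hr]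
        ring
      · have hx : ∀ v ∈ G.barren A, x v = 0 := by
          intro v hv
          have hv1 : x v ≠ 1 := fun h => h1 ⟨v, hv, h⟩
          revert hv1
          generalize x v = t
          fin_cases t <;> simp
        obtain ⟨v, hv⟩ := G.barren_nonempty hne
        have hvA := G.barren_subset A hv
        have hsp := hA.splits_dis hvA
        have hAE : G.dis A {v} ∪ (A \ G.dis A {v}) = A :=
          Finset.union_sdiff_of_subset (dis_subset hvA)
        have hself := self_mem_dis (G := G) A v
        have hconn := fun e (he : e ∈ G.dis A {v}) => dis_self_biConn he
        have hanA := hA.an_subset (dis_subset (G := G) hvA)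
        generalize G.dis A {v} = E at *
        generalize A \ E = F at *
        subst hAE
        rcases hanA.eq_or_ssubset with hEq | hlt
        · have hbE : G.barren E = G.barren (E ∪ F) := by rw [← hEq, barren_an]
          rw [guardedSum_of_pos P hp]
          refine hG.real_eq_guardedSum_of_an_eq P hsp hEq hself hconn (fun x => ?_)
            (by rwa [hbE]) hp
          exact ih _ (Finset.sdiff_ssubset ((G.barren_subset E).trans Finset.subset_union_left)
            (G.barren_nonempty ⟨v, hself⟩)) (hA.sdiff_barren hbE.le) x
        · exact hG.real_eq_guardedSum_of_an_ssubset P hsp hlt hself hv hconn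
            (fun B hB hBa => ih B hB hBa) x

end Factorization

end ADMG

namespace ADMG

section Walks

variable {V : Type*} [Fintype V] [DecidableEq V] {G : ADMG V}

/-- The sequence of `n` edges is a walk on which every collider is an ancestor of `C` and every
other inner vertex lies outside `C`. -/
structure IsOpenSeq (G : ADMG V) (C : Finset V) (n : ℕ) (vert : ℕ → V) (edge : ℕ → EdgeKind) :
    Prop where
  hasEdge : ∀ i < n, G.HasEdge (edge i) (vert i) (vert (i + 1))
  collider : ∀ i, i + 1 < n → (edge i).ArrowAtEnd → (edge (i + 1)).ArrowAtStart →
    ∃ c ∈ C, G.Anc (vert (i + 1)) c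
  nonCollider : ∀ i, i + 1 < n → ¬ ((edge i).ArrowAtEnd ∧ (edge (i + 1)).ArrowAtStart) →
    vert (i + 1) ∉ C

theorem IsOpenSeq.forward_run {C : Finset V} {n : ℕ} {vert : ℕ → V} {edge : ℕ → EdgeKind}
    (h : G.IsOpenSeq C n vert edge) {i : ℕ} (hi : i < n) (he : edge i = .forward) (m : ℕ)
    (hm : i + m < n) :
    (edge (i + m) = .forward ∧ Relation.TransGen G.dir (vert i) (vert (i + m + 1))) ∨
      ∃ c ∈ C, G.Anc (vert i) c := by
  induction m with
  | zero =>
    have hE := h.hasEdge i hi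
    rw [he] at hE
    exact Or.inl ⟨he, Relation.TransGen.single hE⟩
  | succ m ih =>
    rcases ih (by omega) with ⟨h1, h2⟩ | h1
    · by_cases h3 : (edge (i + m + 1)).ArrowAtStart
      · obtain ⟨c, hc, hac⟩ := h.collider (i + m) hm (by rw [h1]; trivial) h3
        exact Or.inr ⟨c, hc, h2.to_reflTransGen.trans hac⟩
      · have h4 := EdgeKind.eq_forward_of_not_arrowAtStart h3
        have hE := h.hasEdge (i + m + 1) hm
        rw [h4] at hE
        exact Or.inl ⟨h4, h2.tail hE⟩
    · exact Or.inr h1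

theorem IsOpenSeq.splice {C : Finset V} {n : ℕ} {vert : ℕ → V} {edge : ℕ → EdgeKind}
    (h : G.IsOpenSeq C n vert edge) {i d : ℕ} (hd : 0 < d) (hn : i + d ≤ n)
    (heq : vert i = vert (i + d)) :
    G.IsOpenSeq C (n - d) (fun k => if k ≤ i then vert k else vert (k + d))
      (fun k => if k < i then edge k else edge (k + d)) := by
  have hv1 : ∀ k, k ≤ i → (if k ≤ i then vert k else vert (k + d)) = vert k :=
    fun k hk => if_pos hk
  have hv2 : ∀ k, i ≤ k → (if k ≤ i then vert k else vert (k + d)) = vert (k + d) := by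
    intro k hk
    rcases hk.eq_or_lt with rfl | hk
    · rw [if_pos le_rfl, heq]
    · exact if_neg (by omega)
  have he1 : ∀ k, k < i → (if k < i then edge k else edge (k + d)) = edge k :=
    fun k hk => if_pos hk
  have he2 : ∀ k, i ≤ k → (if k < i then edge k else edge (k + d)) = edge (k + d) :=
    fun k hk => if_neg (by omega)
  refine ⟨fun k hk => ?_, fun k hk hc1 hc2 => ?_, fun k hk hc => ?_⟩
  · rcases lt_or_ge k i with hki | hki
    · rw [he1 k hki, hv1 k hki.le, hv1 (k + 1) hki]
      exact h.hasEdge k (by omega)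
    · rw [he2 k hki, hv2 k hki, hv2 (k + 1) (by omega), Nat.add_right_comm k 1 d]
      exact h.hasEdge (k + d) (by omega)
  · rcases lt_trichotomy (k + 1) i with hki | hki | hki
    · rw [he1 k (by omega)] at hc1
      rw [he1 (k + 1) hki] at hc2
      rw [hv1 (k + 1) hki.le]
      exact h.collider k (by omega) hc1 hc2
    · rw [he1 k (by omega)] at hc1
      rw [he2 (k + 1) hki.ge] at hc2
      rw [hv1 (k + 1) hki.le]
      by_cases h3 : (edge (k + 1)).ArrowAtStart
      · exact h.collider k (by omega) hc1 h3
      · have h4 := EdgeKind.eq_forward_of_not_arrowAtStart h3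
        rcases h.forward_run (i := k + 1) (by omega) h4 (d - 1) (by omega) with ⟨-, h5⟩ | h5
        · rw [show k + 1 + (d - 1) + 1 = i + d by omega, ← heq, hki] at h5
          exact absurd h5 (G.acyclic _)
        · exact h5
    · rw [he2 k (by omega)] at hc1
      rw [he2 (k + 1) hki.le, Nat.add_right_comm k 1 d] at hc2
      rw [hv2 (k + 1) hki.le, Nat.add_right_comm k 1 d]
      exact h.collider (k + d) (by omega) hc1 hc2
  · rcases lt_trichotomy (k + 1) i with hki | hki | hki
    · rw [he1 k (by omega), he1 (k + 1) hki] at hc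
      rw [hv1 (k + 1) hki.le]
      exact h.nonCollider k (by omega) hc
    · rw [he1 k (by omega), he2 (k + 1) hki.ge] at hc
      rw [hv1 (k + 1) hki.le]
      intro hC
      have h1 := not_imp_not.mpr (h.nonCollider k (by omega)) (not_not.mpr hC)
      have hC' : vert (i + d - 1 + 1) ∈ C := by
        rw [show i + d - 1 + 1 = i + d by omega, ← heq, ← hki]
        exact hC
      have h2 := not_imp_not.mpr (h.nonCollider (i + d - 1) (by omega)) (not_not.mpr hC')
      rw [not_not] at h1 h2
      rw [show i + d - 1 + 1 = k + 1 + d by omega] at h2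
      exact hc ⟨h1.1, h2.2⟩
    · rw [he2 k (by omega), he2 (k + 1) hki.le, Nat.add_right_comm k 1 d] at hc
      rw [hv2 (k + 1) hki.le, Nat.add_right_comm k 1 d]
      exact h.nonCollider (k + d) (by omega) hc

/-- m-separation excludes open walks, not only open paths. -/
theorem MSep.not_isOpenSeq {A B C : Finset V} (hsep : G.MSep A B C) (n : ℕ) (vert : ℕ → V)
    (edge : ℕ → EdgeKind) (h : G.IsOpenSeq C n vert edge) (hA : vert 0 ∈ A) : vert n ∉ B := by
  induction n using Nat.strong_induction_on generalizing vert edge with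
  | _ n ih =>
    intro hB
    have hinj : ∀ i d, 0 < d → i + d ≤ n → vert i ≠ vert (i + d) := by
      intro i d hd hn heq
      refine ih (n - d) (by omega) _ _ (h.splice hd hn heq) ?_ ?_
      · simpa using hA
      · rcases hn.eq_or_lt with h1 | h1
        · have h2 : n - d = i := by omega
          simp only [h2, le_refl, if_true]
          rw [heq, h1]
          exact hB
        · have h2 : ¬ n - d ≤ i := by omega
          simp only [h2, if_false]
          rwa [Nat.sub_add_cancel (by omega)]
    refine absurd (hsep _ hA _ hB ⟨n, vert, edge, rfl, rfl, h.hasEdge, ?_⟩) ?_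
    · intro i hi j hj hij
      by_contra hne
      rw [Set.mem_Iic] at hi hj
      rcases Nat.lt_or_gt_of_ne hne with hlt | hlt
      · refine hinj i (j - i) (by omega) (by omega) ?_
        rw [hij, Nat.add_sub_cancel' hlt.le]
      · refine hinj j (i - j) (by omega) (by omega) ?_
        rw [← hij, Nat.add_sub_cancel' hlt.le]
    · rintro (⟨i, hi, hc, hC⟩ | ⟨i, hi, hc, hC⟩)
      · exact h.nonCollider i hi hc hC
      · exact hC (h.collider i hi hc.1 hc.2)

/-- `OpenWalk A C k v`: some walk from a vertex of `A` to `v` is open given `C`, its last edge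
being of kind `k` (`backward` for the walk of length `0`). -/
inductive OpenWalk (G : ADMG V) (A C : Finset V) : EdgeKind → V → Prop
  | start {a : V} (ha : a ∈ A) : OpenWalk G A C .backward a
  | step {k k' : EdgeKind} {v w : V} (h : OpenWalk G A C k v) (e : G.HasEdge k' v w)
      (hc : k.ArrowAtEnd → k'.ArrowAtStart → ∃ c ∈ C, G.Anc v c)
      (hn : ¬ (k.ArrowAtEnd ∧ k'.ArrowAtStart) → v ∉ C) : OpenWalk G A C k' w

theorem OpenWalk.exists_isOpenSeq {A C : Finset V} {k : EdgeKind} {v : V}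
    (h : G.OpenWalk A C k v) : ∃ n vert edge, G.IsOpenSeq C n vert edge ∧ vert 0 ∈ A ∧
      vert n = v ∧ ∀ m, n = m + 1 → edge m = k := by
  induction h with
  | @start a ha =>
    exact ⟨0, fun _ => a, fun _ => .backward, ⟨by simp, by simp, by simp⟩, ha, rfl, by simp⟩
  | @step k k' v w _ e hc hn ih =>
    obtain ⟨n, vert, edge, hs, h0, hv, hk⟩ := ih
    have hv1 : ∀ i ≤ n, Function.update vert (n + 1) w i = vert i :=
      fun i hi => Function.update_of_ne (by omega) _ _
    have he1 : ∀ i < n, Function.update edge n k' i = edge i :=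
      fun i hi => Function.update_of_ne (by omega) _ _
    refine ⟨n + 1, Function.update vert (n + 1) w, Function.update edge n k',
      ⟨fun i hi => ?_, fun i hi h1 h2 => ?_, fun i hi h1 => ?_⟩, ?_, ?_, ?_⟩
    · rcases (Nat.lt_succ_iff.mp hi).eq_or_lt with rfl | hi'
      · rw [Function.update_self, Function.update_self, hv1 i le_rfl, hv]
        exact e
      · rw [he1 i hi', hv1 i hi'.le, hv1 (i + 1) hi']
        exact hs.hasEdge i hi'
    · rw [he1 i (by omega)] at h1
      rw [hv1 (i + 1) (by omega)]
      rcases (Nat.lt_succ_iff.mp hi).eq_or_lt with rfl | hi'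
      · rw [Function.update_self] at h2
        rw [hk i rfl] at h1
        rw [hv]
        exact hc h1 h2
      · rw [he1 _ hi'] at h2
        exact hs.collider i hi' h1 h2
    · rw [he1 i (by omega)] at h1
      rw [hv1 (i + 1) (by omega)]
      rcases (Nat.lt_succ_iff.mp hi).eq_or_lt with rfl | hi'
      · rw [Function.update_self, hk i rfl] at h1
        rw [hv]
        exact hn h1
      · rw [he1 _ hi'] at h1
        exact hs.nonCollider i hi' h1
    · rwa [hv1 0 (by omega)]
    · exact Function.update_self _ _ _
    · intro m hm
      obtain rfl : n = m := by omega
      exact Function.update_self _ _ _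

theorem MSep.not_openWalk {A B C : Finset V} (hsep : G.MSep A B C) {k : EdgeKind} {b : V}
    (hb : b ∈ B) : ¬ G.OpenWalk A C k b := by
  intro h
  obtain ⟨n, vert, edge, hs, h0, hv, -⟩ := h.exists_isOpenSeq
  exact hsep.not_isOpenSeq n vert edge hs h0 (hv ▸ hb)

theorem openWalk_backward_of_anc {A C : Finset V} {v a : V} (ha : a ∈ A) (h : G.Anc v a)
    (hC : ¬ ∃ c ∈ C, G.Anc v c) : G.OpenWalk A C .backward v := by
  induction h using Relation.ReflTransGen.head_induction_on with
  | refl => exact .start ha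
  | @head u w huw _ ih =>
    have hwC : ¬ ∃ c ∈ C, G.Anc w c := fun ⟨c, hc, hwc⟩ => hC ⟨c, hc, hwc.head huw⟩
    exact .step (k' := .backward) (ih hwC) huw (fun h => h.elim)
      fun _ hw => hwC ⟨w, hw, Relation.ReflTransGen.refl⟩

theorem OpenWalk.exists_of_anc {A C : Finset V} {v b : V} (h : G.Anc v b)
    (hC : ¬ ∃ c ∈ C, G.Anc v c) {k : EdgeKind} (hk : G.OpenWalk A C k v) :
    ∃ k', G.OpenWalk A C k' b := by
  induction h using Relation.ReflTransGen.head_induction_on generalizing k with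
  | refl => exact ⟨k, hk⟩
  | @head u w huw _ ih =>
    have hwC : ¬ ∃ c ∈ C, G.Anc w c := fun ⟨c, hc, hwc⟩ => hC ⟨c, hc, hwc.head huw⟩
    exact ih hwC (.step (k' := .forward) hk huw (fun _ h => h.elim)
      fun _ hu => hC ⟨u, hu, Relation.ReflTransGen.refl⟩)

theorem MSep.openWalk_backward {A B C : Finset V} (hsep : G.MSep A B C) {v : V}
    (hv : v ∈ G.an (A ∪ B ∪ C)) {k : EdgeKind} (hk : G.OpenWalk A C k v)
    (hC : ¬ ∃ c ∈ C, G.Anc v c) : G.OpenWalk A C .backward v := by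
  obtain ⟨w, hw, hvw⟩ := G.mem_an.mp hv
  rcases Finset.mem_union.mp hw with hw | hw
  · rcases Finset.mem_union.mp hw with hw | hw
    · exact openWalk_backward_of_anc hw hvw hC
    · obtain ⟨k', hk'⟩ := hk.exists_of_anc hvw hC
      exact absurd hk' (hsep.not_openWalk hw)
  · exact absurd ⟨w, hw, hvw⟩ hC

theorem MSep.openWalk_extend {A B C : Finset V} (hsep : G.MSep A B C) {v : V}
    (hv : v ∈ G.an (A ∪ B ∪ C)) {k : EdgeKind} (hk : G.OpenWalk A C k v)
    (hkC : k.ArrowAtEnd ∨ v ∉ C) {k' : EdgeKind} (hk' : k'.ArrowAtStart) {w : V}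
    (e : G.HasEdge k' v w) : G.OpenWalk A C k' w := by
  by_cases hC : ∃ c ∈ C, G.Anc v c
  · refine .step hk e (fun _ _ => hC) fun h => ?_
    exact hkC.resolve_left fun h' => h ⟨h', hk'⟩
  · exact .step (hsep.openWalk_backward hv hk hC) e (fun h => h.elim)
      fun _ hvC => hC ⟨v, hvC, Relation.ReflTransGen.refl⟩

theorem MSep.openWalk_district {A B C : Finset V} (hsep : G.MSep A B C) {v : V}
    (hv : v ∈ G.an (A ∪ B ∪ C)) {u w : V}
    (hu : u ∈ G.dis (G.an (A ∪ B ∪ C)) {v} ∪ G.pa (G.dis (G.an (A ∪ B ∪ C)) {v}))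
    (hw : w ∈ G.dis (G.an (A ∪ B ∪ C)) {v} ∪ G.pa (G.dis (G.an (A ∪ B ∪ C)) {v}))
    (huC : u ∉ C) (hk : ∃ k, G.OpenWalk A C k u) : ∃ k, G.OpenWalk A C k w := by
  obtain ⟨k, hk⟩ := hk
  have hED := dis_subset (G := G) hv
  have hconn := fun e (he : e ∈ G.dis (G.an (A ∪ B ∪ C)) {v}) => dis_self_biConn he
  generalize G.dis (G.an (A ∪ B ∪ C)) {v} = E at *
  obtain ⟨e₀, he₀, k₀, hk₀, hkC⟩ :
      ∃ e₀ ∈ E, ∃ k₀, G.OpenWalk A C k₀ e₀ ∧ (k₀.ArrowAtEnd ∨ e₀ ∉ C) := by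
    rcases Finset.mem_union.mp hu with h | h
    · exact ⟨u, h, k, hk, Or.inr huC⟩
    · obtain ⟨e, he, hue⟩ := G.mem_pa.mp h
      exact ⟨e, he, .forward, .step (k' := .forward) hk hue (fun _ h => h.elim) fun _ => huC,
        Or.inl trivial⟩
  have hall : ∀ e ∈ E, ∃ k, G.OpenWalk A C k e ∧ (k.ArrowAtEnd ∨ e ∉ C) := by
    intro e he
    have h1 := (G.biConn_symm (hconn e₀ he₀)).trans (hconn e he)
    induction h1 with
    | refl => exact ⟨k₀, hk₀, hkC⟩
    | @tail b c _ hbc ih =>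
      obtain ⟨k, hk, hkb⟩ := ih hbc.1
      exact ⟨.bidirected, hsep.openWalk_extend (k' := .bidirected) (hED hbc.1) hk hkb trivial hbc.2.2,
        Or.inl trivial⟩
  rcases Finset.mem_union.mp hw with h | h
  · obtain ⟨k, hk, -⟩ := hall w h
    exact ⟨k, hk⟩
  · obtain ⟨e, he, hwe⟩ := G.mem_pa.mp h
    obtain ⟨k, hk, hke⟩ := hall e he
    exact ⟨.backward, hsep.openWalk_extend (k' := .backward) (hED he) hk hke trivial hwe⟩

end Walks

end ADMG

section Discrete

variable {V : Type*} [Fintype V] [DecidableEq V] (P : Measure (V → Fin 2))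
  [IsFiniteMeasure P]

theorem sum_real_coordEvent (D : Finset V) (U : Set (V → Fin 2)) [DecidablePred (· ∈ U)]
    (hU : ∀ x y, (∀ v ∈ D, x v = y v) → x ∈ U → y ∈ U) :
    ∑ y ∈ Finset.univ.filter (· ∈ U), P.real (coordEvent D y) =
      (Finset.univ.filter fun y : V → Fin 2 => ∀ v ∈ D, y v = 0).card * P.real U := by
  have h1 : ∀ y, P.real (coordEvent D y) =
      ∑ z ∈ Finset.univ.filter (fun z : V → Fin 2 => ∀ v ∈ D, z v = y v), P.real {z} := by
    intro y
    rw [← real_eq_sum]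
    congr 1
    ext z
    simp [coordEvent]
  have h2 : P.real U = ∑ z ∈ Finset.univ.filter (· ∈ U), P.real {z} := by
    rw [← real_eq_sum]
    congr 1
    ext z
    simp
  have h3 : ∀ z : V → Fin 2,
      (Finset.univ.filter fun y : V → Fin 2 => ∀ v ∈ D, z v = y v).card =
      (Finset.univ.filter fun y : V → Fin 2 => ∀ v ∈ D, y v = 0).card := by
    intro z
    refine Finset.card_nbij' (fun y v => if v ∈ D then 0 else y v)
      (fun y v => if v ∈ D then z v else y v) ?_ ?_ ?_ ?_
    · intro y _
      simp +contextual
    · intro y _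
      simp +contextual
    · intro y hy
      simp only [Finset.coe_filter, Finset.mem_univ, true_and, Set.mem_ofPred_eq] at hy
      funext v
      by_cases hv : v ∈ D
      · simp [hv, hy v hv]
      · simp [hv]
    · intro y hy
      simp only [Finset.coe_filter, Finset.mem_univ, true_and, Set.mem_ofPred_eq] at hy
      funext v
      by_cases hv : v ∈ D
      · simp [hv, hy v hv]
      · simp [hv]
  simp only [h1]
  rw [Finset.sum_comm' (t' := Finset.univ.filter (· ∈ U))
    (s' := fun z => Finset.univ.filter fun y : V → Fin 2 => ∀ v ∈ D, z v = y v)]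
  · simp only [Finset.sum_const, h3, nsmul_eq_mul]
    rw [← Finset.mul_sum, ← h2]
  · intro y z
    simp only [Finset.mem_filter, Finset.mem_univ, true_and]
    constructor
    · rintro ⟨h4, h5⟩
      exact ⟨h5, hU y z (fun v hv => (h5 v hv).symm) h4⟩
    · rintro ⟨h4, h5⟩
      exact ⟨hU z y h4 h5, h4⟩

theorem real_inter_mul_of_factor {C L D : Finset V} (hCD : C ⊆ D) {g h : (V → Fin 2) → ℝ}
    (hP : ∀ x, P.real (coordEvent D x) = g x * h x)
    (hg : ∀ x y : V → Fin 2, (∀ v ∈ C, x v = y v) → (∀ v ∈ L, x v = y v) → g x = g y)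
    (hh : ∀ x y : V → Fin 2, (∀ v ∈ C, x v = y v) → (∀ v, v ∉ L → x v = y v) → h x = h y)
    {S T : Set (V → Fin 2)}
    (hS : ∀ x y : V → Fin 2, (∀ v ∈ D, v ∈ L → x v = y v) → x ∈ S → y ∈ S)
    (hT : ∀ x y : V → Fin 2, (∀ v ∈ D, v ∉ L → x v = y v) → x ∈ T → y ∈ T)
    (x : V → Fin 2) :
    P.real ((S ∩ T) ∩ coordEvent C x) * P.real (coordEvent C x) =
      P.real (S ∩ coordEvent C x) * P.real (T ∩ coordEvent C x) := by
  classical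
  have hF : ∀ y z : V → Fin 2, (∀ v ∈ D, y v = z v) → y ∈ coordEvent C x →
      z ∈ coordEvent C x := fun y z hyz hy v hv => by rw [← hyz v (hCD hv)]; exact hy v hv
  have hS' : ∀ y z : V → Fin 2, (∀ v ∈ D, y v = z v) → y ∈ S → z ∈ S :=
    fun y z hyz => hS y z fun v hv _ => hyz v hv
  have hT' : ∀ y z : V → Fin 2, (∀ v ∈ D, y v = z v) → y ∈ T → z ∈ T :=
    fun y z hyz => hT y z fun v hv _ => hyz v hv
  have e1 := sum_real_coordEvent P D ((S ∩ T) ∩ coordEvent C x)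
    fun y z hyz hy => ⟨⟨hS' y z hyz hy.1.1, hT' y z hyz hy.1.2⟩, hF y z hyz hy.2⟩
  have e2 := sum_real_coordEvent P D (coordEvent C x) hF
  have e3 := sum_real_coordEvent P D (S ∩ coordEvent C x)
    fun y z hyz hy => ⟨hS' y z hyz hy.1, hF y z hyz hy.2⟩
  have e4 := sum_real_coordEvent P D (T ∩ coordEvent C x)
    fun y z hyz hy => ⟨hT' y z hyz hy.1, hF y z hyz hy.2⟩
  have hN : ((Finset.univ.filter fun y : V → Fin 2 => ∀ v ∈ D, y v = 0).card : ℝ) ≠ 0 := by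
    rw [Nat.cast_ne_zero]
    exact Finset.card_ne_zero_of_mem (a := fun _ => 0) (by simp)
  set N : ℝ := ((Finset.univ.filter fun y : V → Fin 2 => ∀ v ∈ D, y v = 0).card : ℝ)
  set swap : (V → Fin 2) × (V → Fin 2) → (V → Fin 2) × (V → Fin 2) :=
    fun q => (fun v => if v ∈ L then q.1 v else q.2 v, fun v => if v ∈ L then q.2 v else q.1 v)
    with hswap
  have hinv : ∀ q, swap (swap q) = q := by
    intro q
    refine Prod.ext (funext fun v => ?_) (funext fun v => ?_) <;>
      · by_cases hv : v ∈ L <;> simp [hswap, hv]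
  have hsF : ∀ q : (V → Fin 2) × (V → Fin 2), q.1 ∈ coordEvent C x → q.2 ∈ coordEvent C x →
      (swap q).1 ∈ coordEvent C x ∧ (swap q).2 ∈ coordEvent C x := by
    intro q h1 h2
    constructor <;>
    · intro v hv
      by_cases hvL : v ∈ L
      · simp [hswap, hvL, h1 v hv, h2 v hv]
      · simp [hswap, hvL, h1 v hv, h2 v hv]
  have main : (∑ y ∈ Finset.univ.filter (· ∈ (S ∩ T) ∩ coordEvent C x), P.real (coordEvent D y)) *
      (∑ y ∈ Finset.univ.filter (· ∈ coordEvent C x), P.real (coordEvent D y)) =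
      (∑ y ∈ Finset.univ.filter (· ∈ S ∩ coordEvent C x), P.real (coordEvent D y)) *
      (∑ y ∈ Finset.univ.filter (· ∈ T ∩ coordEvent C x), P.real (coordEvent D y)) := by
    rw [Finset.sum_mul_sum, Finset.sum_mul_sum, ← Finset.sum_product', ← Finset.sum_product']
    refine Finset.sum_nbij' swap swap ?_ ?_ (fun q _ => hinv q) (fun q _ => hinv q) ?_
    · rintro ⟨y, z⟩ hq
      simp only [Finset.mem_product, Finset.mem_filter, Finset.mem_univ, true_and,
        Set.mem_inter_iff] at hq ⊢
      have hs := hsF (y, z) hq.1.2 hq.2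
      refine ⟨⟨hS y _ (fun v _ hv => ?_) hq.1.1.1, hs.1⟩,
        ⟨hT y _ (fun v _ hv => ?_) hq.1.1.2, hs.2⟩⟩
      · simp [hswap, hv]
      · simp [hswap, hv]
    · rintro ⟨y, z⟩ hq
      simp only [Finset.mem_product, Finset.mem_filter, Finset.mem_univ, true_and,
        Set.mem_inter_iff] at hq ⊢
      have hs := hsF (y, z) hq.1.2 hq.2.2
      refine ⟨⟨⟨hS y _ (fun v _ hv => ?_) hq.1.1, hT z _ (fun v _ hv => ?_) hq.2.1⟩, hs.1⟩, hs.2⟩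
      · simp [hswap, hv]
      · simp [hswap, hv]
    · rintro ⟨y, z⟩ hq
      simp only [Finset.mem_product, Finset.mem_filter, Finset.mem_univ, true_and,
        Set.mem_inter_iff] at hq
      have hy := hq.1.2
      have hz := hq.2
      obtain ⟨hs1, hs2⟩ := hsF (y, z) hy hz
      simp only [hP]
      rw [hg (swap (y, z)).1 y (fun v hv => (hs1 v hv).trans (hy v hv).symm)
          (fun v hv => by simp [hswap, hv]),
        hh (swap (y, z)).1 z (fun v hv => (hs1 v hv).trans (hz v hv).symm)
          (fun v hv => by simp [hswap, hv]),
        hg (swap (y, z)).2 z (fun v hv => (hs2 v hv).trans (hz v hv).symm)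
          (fun v hv => by simp [hswap, hv]),
        hh (swap (y, z)).2 y (fun v hv => (hs2 v hv).trans (hy v hv).symm)
          (fun v hv => by simp [hswap, hv])]
      ring
  rw [e1, e2, e3, e4] at main
  refine mul_left_cancel₀ (mul_ne_zero hN hN) ?_
  linear_combination main

end Discrete

namespace ADMG

variable {V : Type*} [Fintype V] [DecidableEq V] {G : ADMG V} (P : Measure (V → Fin 2))
  [IsProbabilityMeasure P]

theorem globalMarkov_of_real_eq_guardedSum
    (hF : ∀ D, G.IsAncestral D → ∀ x, P.real (coordEvent D x) = G.guardedSum P D x) :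
    G.GlobalMarkov P := by
  classical
  intro A B C _ _ _ hAC hBC hsep
  set D := G.an (A ∪ B ∪ C) with hD
  have hDa : G.IsAncestral D := G.isAncestral_an _
  have hABC : A ∪ B ∪ C ⊆ D := G.subset_an _
  set D₁ := D.filter fun v => ∀ u ∈ G.dis D {v} ∪ G.pa (G.dis D {v}), u ∉ C →
    ∃ k, G.OpenWalk A C k u with hD₁
  have hsub : D₁ ⊆ D := Finset.filter_subset _ _
  have hsplit : G.Splits D₁ (D \ D₁) := by
    refine ⟨by rwa [Finset.union_sdiff_of_subset hsub], Finset.disjoint_sdiff,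
      fun a ha b hb hab => ?_⟩
    rw [Finset.mem_sdiff] at hb
    have ha' := Finset.mem_filter.mp ha
    refine hb.2 (Finset.mem_filter.mpr ⟨hb.1, fun u hu => ha'.2 u ?_⟩)
    have hle : G.dis D {b} ⊆ G.dis D {a} := by
      intro w hw
      obtain ⟨b', hb', hbw⟩ := G.mem_dis.mp hw
      rw [Finset.mem_singleton] at hb'
      subst hb'
      exact G.mem_dis.mpr ⟨a, Finset.mem_singleton_self a, hbw.head ⟨ha'.1, hb.1, hab⟩⟩
    exact Finset.union_subset_union hle (G.pa_mono hle) hu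
  have hmem : ∀ W : Finset V, ∀ u ∈ W ∪ G.pa W,
      ∃ v ∈ W, u ∈ G.dis D {v} ∪ G.pa (G.dis D {v}) := by
    intro W u hu
    rcases Finset.mem_union.mp hu with h | h
    · exact ⟨u, h, Finset.mem_union_left _ (self_mem_dis D u)⟩
    · obtain ⟨v, hv, huv⟩ := G.mem_pa.mp h
      exact ⟨v, hv, Finset.mem_union_right _ (G.mem_pa.mpr ⟨v, self_mem_dis D v, huv⟩)⟩
  have h₁ : ∀ u ∈ D₁ ∪ G.pa D₁, u ∉ C → ∃ k, G.OpenWalk A C k u := by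
    intro u hu huC
    obtain ⟨v, hv, huv⟩ := hmem _ u hu
    exact (Finset.mem_filter.mp hv).2 u huv huC
  have h₂ : ∀ u ∈ (D \ D₁) ∪ G.pa (D \ D₁), u ∉ C → ¬ ∃ k, G.OpenWalk A C k u := by
    intro u hu huC hk
    obtain ⟨v, hv, huv⟩ := hmem _ u hu
    rw [Finset.mem_sdiff] at hv
    exact hv.2 (Finset.mem_filter.mpr ⟨hv.1, fun w hw _ =>
      hsep.openWalk_district hv.1 huv hw huC hk⟩)
  set L := Finset.univ.filter fun u => ∃ k, G.OpenWalk A C k u with hL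
  have hmL : ∀ u, u ∈ L ↔ ∃ k, G.OpenWalk A C k u := fun u => by simp [hL]
  refine condIndepFun_of_real_inter P fun s t x => ?_
  refine real_inter_mul_of_factor P (L := L) (D := D)
    (g := G.guardedSum P D₁) (h := G.guardedSum P (D \ D₁))
    (Finset.subset_union_right.trans hABC) (fun x => ?_) (fun x y hC hl => ?_)
    (fun x y hC hl => ?_) (fun x y hxy hx => ?_) (fun x y hxy hx => ?_) x
  · rw [← hsplit.guardedSum_union, Finset.union_sdiff_of_subset hsub]
    exact hF D hDa x
  · refine hsplit.guardedSum_congr P fun u hu => ?_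
    by_cases huC : u ∈ C
    · exact hC u huC
    · exact hl u ((hmL u).mpr (h₁ u hu huC))
  · refine hsplit.symm.guardedSum_congr P fun u hu => ?_
    by_cases huC : u ∈ C
    · exact hC u huC
    · exact hl u fun h => h₂ u hu huC ((hmL u).mp h)
  · have : Finset.restrict (π := fun _ : V => Fin 2) A y = Finset.restrict A x := by
      funext a
      refine (hxy a (hABC (Finset.mem_union_left _ (Finset.mem_union_left _ a.2)))
        ((hmL a).mpr ⟨_, .start a.2⟩)).symm
    rw [Set.mem_preimage, this]
    exact hx
  · have : Finset.restrict (π := fun _ : V => Fin 2) B y = Finset.restrict B x := by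
      funext b
      refine (hxy b (hABC (Finset.mem_union_left _ (Finset.mem_union_right _ b.2)))
        fun h => ?_).symm
      obtain ⟨k, hk⟩ := (hmL b).mp h
      exact hsep.not_openWalk b.2 hk
    rw [Set.mem_preimage, this]
    exact hx

end ADMG

theorem mainTheorem2 {V : Type*} [Fintype V] [DecidableEq V] (G : ADMG V)
    (P : Measure (V → Fin 2)) [IsProbabilityMeasure P] :
    G.GlobalMarkov P ↔
      ∀ A : Finset V, G.IsAncestral A → ∀ x : V → Fin 2,
        -- every conditional probability occurring in the formula is defined
        (∀ C : Finset V, A.filter (fun v => x v = 0) ⊆ C → C ⊆ A →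
          ∀ H ∈ G.part C, 0 < P (coordEvent (G.tail H) x)) →
        P.real (coordEvent A x) =
          ∑ C ∈ Finset.Icc (A.filter fun v => x v = 0) A,
            (-1 : ℝ) ^ (C \ A.filter fun v => x v = 0).card *
              ∏ H ∈ G.part C, condZero P H (G.tail H) x := by
  constructor
  · intro hG A hA x hp
    rw [hG.real_eq_guardedSum P A hA x, ADMG.guardedSum_of_pos P hp]
    rfl
  · intro h
    refine ADMG.globalMarkov_of_real_eq_guardedSum P fun A hA x => ?_
    by_cases hp : G.TailsPos P A x
    · rw [ADMG.guardedSum_of_pos P hp]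
      exact h A hA x hp
    · rw [ADMG.guardedSum_of_not P hp, hA.real_coordEvent_of_not_tailsPos P hp]
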